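/- Let $\mathbb F$ be a finite field with $q$ elements and let $R\in(0,1)$. There are $K$ users, $N$ servers and $L$ subfunctions with outputs $W_1,\dots,W_L\in\mathbb F$. User $k$ requests $F_k=\sum_{\ell} f_{k,\ell}W_\ell$, and $\mathbf F=(f_{k,\ell})\in\mathbb F^{K\times L}$ is the demand matrix. A (one-shot) scheme for $\mathbf F$ is a pair $\mathbf D\in\mathbb F^{K\times N}$, $\mathbf E\in\mathbb F^{N\times L}$: server $n$ transmits $z_n=\sum_\ell \mathbf E(n,\ell)W_\ell$, user $k$ computes $\sum_n \mathbf D(k,n)z_n$, and this must equal $F_k$ for all $k$ and all values of $W_1,\dots,W_L$. Its normalized computation cost is $\frac1N\max_\ell\omega(\mathbf E(:,\ell))$ and its normalized communication cost is $\delta=\frac{\omega(\mathbf D)}{KN}$, where $\omega$ counts nonzero entries. Let $H_q(x)=x\log_q(q-1)-x\log_q x-(1-x)\log_q(1-x)$ on $[0,1-\frac1q]$, and let $H_q^{-1}:[0,1]\to[0,1-\frac1q]$ be its inverse. Let $N\to\infty$ with $K=K_N$ and $K_N/N\to R$. (i) There is $\varepsilon(N)\to0$ such that, for all large $N$, every $L$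 and every $\mathbf F\in\mathbb F^{K_N\times L}$, the optimal (i.e. least) computation cost $\gamma^*$ over all schemes for $\mathbf F$ exists and satisfies $\gamma^*\le H_q^{-1}\!\left(\frac{K_N}{N}\right)+\varepsilon(N)$; if the columns of $\mathbf F$ are distinct, then also $H_q^{-1}\!\left(\frac{\log_q L}{N}\right)\le\gamma^*$. (ii) Let $L=L_N$ with $\frac{\log_q L_N}{N}\to R_f$ for some $R_f>0$. Call $\gamma$ achievable if, for some $\varepsilon(N)\to0$ and all large $N$, every $\mathbf F\in\mathbb F^{K_N\times L_N}$ has a scheme with computation cost at most $\gamma+\varepsilon(N)$. If $\gamma\le\min\{\frac{\sqrt5-1}2,\,1-\frac1q\}$ is achievable, then for some $\varepsilon'(N)\to0$ and all large $N$, every $\mathbf F\in\mathbb F^{K_N\times L_N}$ has a scheme with computation cost at most $\gamma+\varepsilon'(N)$ and with $$c\,\frac{\sqrt{\log_q N}}{N}\;\le\;\delta\;\le\; C\,\frac{\sqrt{\log_q N}}{N},$$ whose decoding matrix $\mathbf D$ is block diagonal with blocks of at most $C\sqrt{\log_q N}$ columns. Here $c,C>0$ depend only on $\mathbb F$ and $R$.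 -/

import Mathlib

open Filter Topology

/-- The `q`-ary entropy function (logarithms to base `q`),
`H_q(x) = x log_q (q - 1) - x log_q x - (1 - x) log_q (1 - x)`. -/
noncomputable def entropyQ (q : ℕ) (x : ℝ) : ℝ :=
  x * Real.logb q (q - 1) - x * Real.logb q x - (1 - x) * Real.logb q (1 - x)

/-- The inverse of `H_q`, where `H_q` is regarded as a function on `[0, 1 - 1/q]`
(it is a strictly increasing bijection onto `[0, 1]`). -/
noncomputable def entropyQInv (q : ℕ) (y : ℝ) : ℝ :=
  Function.invFunOn (entropyQ q) (Set.Icc 0 (1 - 1 / (q : ℝ))) y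

/-- A one-shot scheme with `N` servers for the `K` users whose requested functions are
`F_k = ∑ ℓ, F k ℓ * W_ℓ`, where `W_ℓ` is the output of the `ℓ`-th subfunction.
Server `n` transmits `z_n = ∑ ℓ, E n ℓ * W_ℓ`, user `k` decodes `∑ n, D k n * z_n`, and decoding
is successful for all values of the subfunction outputs. -/
structure Scheme {𝔽 : Type*} [Field 𝔽] (N : ℕ) {K L : ℕ} (F : Matrix (Fin K) (Fin L) 𝔽) where
  /-- the decoding matrix -/
  D : Matrix (Fin K) (Fin N) 𝔽
  /-- the encoding matrix -/
  E : Matrix (Fin N) (Fin L) 𝔽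
  /-- every user recovers its requested function -/
  decodes : ∀ w : Fin L → 𝔽, D.mulVec (E.mulVec w) = F.mulVec w

namespace Scheme

variable {𝔽 : Type*} [Field 𝔽] [DecidableEq 𝔽] {N K L : ℕ} {F : Matrix (Fin K) (Fin L) 𝔽}

/-- The set of servers that compute the `ℓ`-th subfunction. -/
def servers (s : Scheme N F) (ℓ : Fin L) : Finset (Fin N) :=
  Finset.univ.filter fun n => s.E n ℓ ≠ 0

/-- The set of users that receive the transmission of server `n`. -/
def users (s : Scheme N F) (n : Fin N) : Finset (Fin K) :=
  Finset.univ.filter fun k => s.D k n ≠ 0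

/-- Normalized computation cost: the largest fraction of the servers that compute one
subfunction. -/
noncomputable def compCost (s : Scheme N F) : ℝ :=
  ((Finset.univ.sup fun ℓ : Fin L => (s.servers ℓ).card : ℕ) : ℝ) / N

/-- Normalized communication cost: the average fraction of the servers that a user gets
data from. -/
noncomputable def commCost (s : Scheme N F) : ℝ :=
  ((∑ n : Fin N, (s.users n).card : ℕ) : ℝ) / (K * N)

end Scheme

/-- The computation costs of all schemes with `N` servers for the demand matrix `F`. The optimal
computation cost for `F` is the least element of this set. -/
def compCosts {𝔽 : Type*} [Field 𝔽] [DecidableEq 𝔽] (N : ℕ) {K L : ℕ}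
    (F : Matrix (Fin K) (Fin L) 𝔽) : Set ℝ :=
  Set.range fun s : Scheme N F => s.compCost

/-- The matrix `D` is block diagonal (rows and columns in their given order) and each of its
blocks has at most `b` columns: row `k` belongs to block `r k` and column `n` to block `c n`. -/
def IsBlockDiagonalWithin {𝔽 : Type*} [Field 𝔽] {K N : ℕ} (D : Matrix (Fin K) (Fin N) 𝔽)
    (b : ℝ) : Prop :=
  ∃ (m : ℕ) (r : Fin K → Fin m) (c : Fin N → Fin m), Monotone r ∧ Monotone c ∧
    (∀ k n, D k n ≠ 0 → r k = c n) ∧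
    ∀ i : Fin m, ((Finset.univ.filter fun n => c n = i).card : ℝ) ≤ b

/-- The computation cost `γ` is achievable, in the limit of large `N`, in the setting with
`K N` users, `N` servers and `L N` subfunctions: whatever the demands of the users are, a scheme of
computation cost at most `γ + o(1)` serves them. -/
def IsAchievable (𝔽 : Type*) [Field 𝔽] [DecidableEq 𝔽] (K L : ℕ → ℕ) (γ : ℝ) : Prop :=
  ∃ ε : ℕ → ℝ, Tendsto ε atTop (𝓝 0) ∧ ∀ᶠ N in atTop,
    ∀ F : Matrix (Fin (K N)) (Fin (L N)) 𝔽, ∃ s : Scheme N F, s.compCost ≤ γ + ε N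

/-!
The columns of `F` are syndromes for the code with parity-check matrix `D`: a scheme with decoding
matrix `D` writes each of them as `D e`, and its computation cost is the largest relative weight of
the vectors `e` that it uses. So the least cost over all `D` and all `F` is about the smallest
relative covering radius of codes of length `N` with `K` parity checks, which is `H_q⁻¹(K / N)`.

*Upper bounds.* A random matrix maps a Hamming ball of at least `q ^ k` vectors onto at least half of
`𝔽 ^ k`, by an estimate of the number of collisions (`exists_card_le_two_mul_card_image`). Each
further well-chosen column squares the proportion of the missed syndromes, so `O(log k)` columns
complete the covering (`exists_snocCol_iterate`). With the estimate `exp_le_card_hammingBall` of the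
volume of balls, this gives one good matrix of relative covering radius `H_q⁻¹(R) + η`. The covering
property passes to direct sums, so direct sums of this matrix yield good matrices with any large
number of columns; one more column makes them dense (`Covers.exists_dense`). Direct sums of about
`N / √(log_q N)` dense blocks with about `√(log_q N)` columns each
(`eventually_exists_blockDiagonal_covers`) serve every demand at cost `H_q⁻¹(R) + o(1)`, with the
communication cost claimed.

*Lower bounds.* Distinct demands need distinct vectors in a Hamming ball, whose volume is at most
`q ^ (N H_q(γ))` (`Scheme.entropyQInv_le_compCost`). If all demand matrices are served at cost `γ`,
then counting them against the pairs `(D, E)` gives `γ ≥ H_q⁻¹(R)` whenever `L` grows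
exponentially (`IsAchievable.entropyQInv_le`). Hence the block diagonal schemes have at most any
achievable computation cost, up to `o(1)`.
-/

/-! ### The `q`-ary entropy function and its inverse -/

theorem entropyQ_eq_qaryEntropy_div_log {q : ℕ} (hq : 2 ≤ q) (x : ℝ) :
    entropyQ q x = Real.qaryEntropy q x / Real.log q := by
  have hq1 : (2 : ℝ) ≤ q := by exact_mod_cast hq
  have : Real.log q ≠ 0 := (Real.log_pos (by linarith)).ne'
  simp only [entropyQ, Real.logb, Real.qaryEntropy, Real.binEntropy, Real.log_inv]
  push_cast
  field_simp
  ring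

theorem entropyQ_mul_log {q : ℕ} (hq : 2 ≤ q) (x : ℝ) :
    entropyQ q x * Real.log q = Real.qaryEntropy q x := by
  have hq1 : (2 : ℝ) ≤ q := by exact_mod_cast hq
  have : Real.log q ≠ 0 := (Real.log_pos (by linarith)).ne'
  rw [entropyQ_eq_qaryEntropy_div_log hq, div_mul_cancel₀ _ this]

theorem continuous_entropyQ {q : ℕ} (hq : 2 ≤ q) : Continuous (entropyQ q) := by
  have : entropyQ q = fun x => Real.qaryEntropy q x / Real.log q :=
    funext (entropyQ_eq_qaryEntropy_div_log hq)
  rw [this]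
  exact Real.qaryEntropy_continuous.div_const _

theorem strictMonoOn_entropyQ {q : ℕ} (hq : 2 ≤ q) :
    StrictMonoOn (entropyQ q) (Set.Icc 0 (1 - 1 / (q : ℝ))) := by
  have hq1 : (2 : ℝ) ≤ q := by exact_mod_cast hq
  have hl : 0 < Real.log q := Real.log_pos (by linarith)
  intro x hx y hy hxy
  rw [entropyQ_eq_qaryEntropy_div_log hq, entropyQ_eq_qaryEntropy_div_log hq]
  exact div_lt_div_of_pos_right (Real.qaryEntropy_strictMonoOn hq hx hy hxy) hl

theorem entropyQ_zero (q : ℕ) : entropyQ q 0 = 0 := by simp [entropyQ]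

theorem entropyQ_one_sub_inv {q : ℕ} (hq : 2 ≤ q) : entropyQ q (1 - 1 / (q : ℝ)) = 1 := by
  have hq1 : (2 : ℝ) ≤ q := by exact_mod_cast hq
  have hl : 0 < Real.log q := Real.log_pos (by linarith)
  have h1 : (1 : ℝ) - 1 / q = (q - 1) / q := by field_simp
  have h2 : (1 : ℝ) - (q - 1) / q = 1 / q := by field_simp; ring
  simp only [entropyQ, Real.logb, h1, h2]
  rw [Real.log_div (by linarith) (by linarith), Real.log_div one_ne_zero (by linarith),
    Real.log_one]
  field_simp
  ring

theorem one_sub_inv_pos {q : ℕ} (hq : 2 ≤ q) : (0 : ℝ) < 1 - 1 / (q : ℝ) := by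
  have hq1 : (2 : ℝ) ≤ q := by exact_mod_cast hq
  rw [sub_pos, div_lt_one (by linarith)]
  linarith

theorem one_sub_inv_lt_one {q : ℕ} (hq : 2 ≤ q) : 1 - 1 / (q : ℝ) < 1 := by
  have hq1 : (2 : ℝ) ≤ q := by exact_mod_cast hq
  have : (0 : ℝ) < 1 / q := by positivity
  linarith

theorem exists_entropyQ_eq {q : ℕ} (hq : 2 ≤ q) {y : ℝ} (hy : y ∈ Set.Icc (0 : ℝ) 1) :
    ∃ x ∈ Set.Icc 0 (1 - 1 / (q : ℝ)), entropyQ q x = y := by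
  have := intermediate_value_Icc (one_sub_inv_pos hq).le (continuous_entropyQ hq).continuousOn
  rw [entropyQ_zero, entropyQ_one_sub_inv hq] at this
  exact this hy

theorem entropyQInv_mem {q : ℕ} (hq : 2 ≤ q) {y : ℝ} (hy : y ∈ Set.Icc (0 : ℝ) 1) :
    entropyQInv q y ∈ Set.Icc 0 (1 - 1 / (q : ℝ)) :=
  Function.invFunOn_mem (exists_entropyQ_eq hq hy)

theorem entropyQ_entropyQInv {q : ℕ} (hq : 2 ≤ q) {y : ℝ} (hy : y ∈ Set.Icc (0 : ℝ) 1) :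
    entropyQ q (entropyQInv q y) = y :=
  Function.invFunOn_eq (exists_entropyQ_eq hq hy)

theorem entropyQInv_le_iff {q : ℕ} (hq : 2 ≤ q) {x y : ℝ} (hy : y ∈ Set.Icc (0 : ℝ) 1)
    (hx : x ∈ Set.Icc 0 (1 - 1 / (q : ℝ))) : entropyQInv q y ≤ x ↔ y ≤ entropyQ q x := by
  rw [← (strictMonoOn_entropyQ hq).le_iff_le (entropyQInv_mem hq hy) hx,
    entropyQ_entropyQInv hq hy]

theorem lt_entropyQInv_iff {q : ℕ} (hq : 2 ≤ q) {x y : ℝ} (hy : y ∈ Set.Icc (0 : ℝ) 1)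
    (hx : x ∈ Set.Icc 0 (1 - 1 / (q : ℝ))) : x < entropyQInv q y ↔ entropyQ q x < y := by
  rw [← not_le, ← not_le, entropyQInv_le_iff hq hy hx]

theorem entropyQInv_pos {q : ℕ} (hq : 2 ≤ q) {y : ℝ} (hy : y ∈ Set.Ioo (0 : ℝ) 1) :
    0 < entropyQInv q y := by
  rw [lt_entropyQInv_iff hq (Set.Ioo_subset_Icc_self hy) ⟨le_rfl, (one_sub_inv_pos hq).le⟩,
    entropyQ_zero]
  exact hy.1

theorem entropyQInv_lt {q : ℕ} (hq : 2 ≤ q) {y : ℝ} (hy : y ∈ Set.Ioo (0 : ℝ) 1) :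
    entropyQInv q y < 1 - 1 / (q : ℝ) := by
  have h := entropyQInv_mem hq (Set.Ioo_subset_Icc_self hy)
  refine lt_of_le_of_ne h.2 fun he => ?_
  have := entropyQ_entropyQInv hq (Set.Ioo_subset_Icc_self hy)
  rw [he, entropyQ_one_sub_inv hq] at this
  exact hy.2.ne this.symm

/-- `H_q⁻¹` is lower semicontinuous in the interior of `[0, 1]`. -/
theorem eventually_lt_entropyQInv {q : ℕ} (hq : 2 ≤ q) {R : ℝ} (hR : R ∈ Set.Ioo (0 : ℝ) 1)
    {r : ℕ → ℝ} (hr : Tendsto r atTop (𝓝 R)) {x : ℝ} (hx : x < entropyQInv q R) :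
    ∀ᶠ N in atTop, x < entropyQInv q (r N) := by
  have hmem : ∀ᶠ N in atTop, r N ∈ Set.Ioo (0 : ℝ) 1 := hr.eventually (isOpen_Ioo.mem_nhds hR)
  rcases lt_or_ge x 0 with h0 | h0
  · filter_upwards [hmem] with N hN
    exact h0.trans (entropyQInv_pos hq hN)
  · have hxm : x ∈ Set.Icc 0 (1 - 1 / (q : ℝ)) := ⟨h0, (hx.trans (entropyQInv_lt hq hR)).le⟩
    have := (lt_entropyQInv_iff hq (Set.Ioo_subset_Icc_self hR) hxm).1 hx
    filter_upwards [hmem, hr.eventually (lt_mem_nhds this)] with N hN hN'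
    exact (lt_entropyQInv_iff hq (Set.Ioo_subset_Icc_self hN) hxm).2 hN'

/-! ### The volume of Hamming balls -/

/-- The Hamming ball of radius `w` about the origin of `𝔽 ^ κ`. -/
def hammingBall (𝔽 : Type*) [Field 𝔽] [Fintype 𝔽] [DecidableEq 𝔽] (κ : Type*) [Fintype κ]
    [DecidableEq κ] (w : ℕ) : Finset (κ → 𝔽) :=
  Finset.univ.filter fun e => hammingNorm e ≤ w

section Volume

variable {𝔽 : Type*} [Field 𝔽] [DecidableEq 𝔽]

/-- `-H_q(x)`, up to the base of the logarithms, is the logarithmic probability per coordinate of a vector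
of relative weight `x`, if the coordinates are independent and take each nonzero value with
probability `x / (q - 1)`. -/
theorem qaryEntropy_eq_neg {q : ℕ} (hq : 2 ≤ q) {x : ℝ} (hx0 : 0 < x) :
    Real.qaryEntropy q x =
      -(x * Real.log (x / (q - 1)) + (1 - x) * Real.log (1 - x)) := by
  have hq1 : (2 : ℝ) ≤ q := by exact_mod_cast hq
  rw [Real.log_div hx0.ne' (by linarith)]
  simp only [Real.qaryEntropy, Real.binEntropy, Real.log_inv]
  push_cast
  ring

theorem prod_ite_eq_zero_eq_pow {κ : Type*} [Fintype κ] [DecidableEq κ] (e : κ → 𝔽) (a b : ℝ) :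
    ∏ i, (if e i = 0 then b else a) =
      a ^ hammingNorm e * b ^ (Fintype.card κ - hammingNorm e) := by
  rw [Finset.prod_ite, Finset.prod_const, Finset.prod_const, mul_comm]
  have h := Finset.card_filter_add_card_filter_not (s := (Finset.univ : Finset κ))
    (fun i => e i = 0)
  have h2 : (Finset.univ.filter fun i => ¬ e i = 0).card = hammingNorm e := rfl
  rw [h2] at h ⊢
  rw [← Finset.card_univ, ← h, Nat.add_sub_cancel]

variable [Fintype 𝔽]

theorem sum_prod_ite_eq_zero {κ : Type*} [Fintype κ] [DecidableEq κ] (a b : ℝ)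
    (hab : b + (Fintype.card 𝔽 - 1) * a = 1) :
    ∑ e : κ → 𝔽, ∏ i, (if e i = 0 then b else a) = 1 := by
  have h := Finset.prod_univ_sum (fun _ : κ => (Finset.univ : Finset 𝔽))
    (fun _ x => if x = 0 then b else a)
  rw [Fintype.piFinset_univ] at h
  rw [← h]
  refine Finset.prod_eq_one fun i _ => ?_
  rw [← Finset.add_sum_erase _ _ (Finset.mem_univ (0 : 𝔽)), if_pos rfl,
    Finset.sum_congr rfl (g := fun _ => a) (fun x hx => if_neg (Finset.ne_of_mem_erase hx)),
    Finset.sum_const, Finset.card_erase_of_mem (Finset.mem_univ _), Finset.card_univ,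
    nsmul_eq_mul, Nat.cast_sub Fintype.card_pos, Nat.cast_one, hab]

/-- The volume of a ball of relative radius `x ≤ 1 - 1/q` is at most `q ^ (n H_q(x))`. The coordinates
are chosen independently, each nonzero with probability `x`; every vector in the ball has
probability at least `q ^ (-n H_q(x))`. -/
theorem card_hammingBall_le {κ : Type*} [Fintype κ] [DecidableEq κ] {q : ℕ}
    (hq : q = Fintype.card 𝔽) {x : ℝ} (hx : x ∈ Set.Icc 0 (1 - 1 / (q : ℝ))) {w : ℕ}
    (hw : (w : ℝ) ≤ x * Fintype.card κ) :
    ((hammingBall 𝔽 κ w).card : ℝ) ≤ Real.exp (Fintype.card κ * Real.qaryEntropy q x) := by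
  have hq2 : 2 ≤ q := hq ▸ Fintype.one_lt_card
  have hq1 : (2 : ℝ) ≤ q := by exact_mod_cast hq2
  rcases hx.1.eq_or_lt with rfl | hx0
  · have hw0 : w = 0 := by
      rw [zero_mul] at hw
      exact_mod_cast le_antisymm hw (Nat.cast_nonneg w)
    have : hammingBall 𝔽 κ w = {0} := by
      ext e
      simp [hammingBall, hw0]
    simp [this]
  set n := Fintype.card κ
  have hx1 : x < 1 := hx.2.trans_lt (one_sub_inv_lt_one hq2)
  have hab : x / (q - 1) ≤ 1 - x := by
    rw [div_le_iff₀ (by linarith)]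
    have h2 := hx.2
    have : x * q ≤ q - 1 := by
      calc x * q ≤ (1 - 1 / (q : ℝ)) * q := by gcongr
        _ = q - 1 := by field_simp
    linarith
  have ha : 0 < x / (q - 1) := div_pos hx0 (by linarith)
  have hb : 0 < 1 - x := by linarith
  have hsum := sum_prod_ite_eq_zero (𝔽 := 𝔽) (κ := κ) (x / (q - 1)) (1 - x) (by
    rw [← hq, mul_div_cancel₀ _ (by linarith : (q : ℝ) - 1 ≠ 0)]; ring)
  have hlow : ∀ e ∈ hammingBall 𝔽 κ w,
      Real.exp (-(n * Real.qaryEntropy q x)) ≤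
        ∏ i, (if e i = 0 then (1 - x) else x / (q - 1)) := by
    intro e he
    have he' : hammingNorm e ≤ w := (Finset.mem_filter.1 he).2
    have hen : hammingNorm e ≤ n := hammingNorm_le_card_fintype
    rw [prod_ite_eq_zero_eq_pow, ← Real.exp_log (mul_pos (pow_pos ha _) (pow_pos hb _)),
      Real.exp_le_exp, Real.log_mul (pow_pos ha _).ne' (pow_pos hb _).ne', Real.log_pow,
      Real.log_pow, qaryEntropy_eq_neg hq2 hx0, Nat.cast_sub hen]
    have hl : Real.log (x / (q - 1)) ≤ Real.log (1 - x) := Real.log_le_log ha hab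
    have he'' : (hammingNorm e : ℝ) ≤ x * n := le_trans (by exact_mod_cast he') hw
    nlinarith [mul_nonneg (sub_nonneg.2 hl) (sub_nonneg.2 he'')]
  have : ((hammingBall 𝔽 κ w).card : ℝ) * Real.exp (-(n * Real.qaryEntropy q x)) ≤ 1 := by
    rw [← hsum, ← nsmul_eq_mul]
    refine (Finset.card_nsmul_le_sum _ _ _ hlow).trans ?_
    refine Finset.sum_le_sum_of_subset_of_nonneg (Finset.subset_univ _) fun e _ _ => ?_
    exact Finset.prod_nonneg fun i _ => by split_ifs <;> linarith
  rwa [Real.exp_neg, ← div_eq_mul_inv, div_le_one (Real.exp_pos _)] at this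

theorem choose_mul_pow_le_card_hammingBall {κ : Type*} [Fintype κ] [DecidableEq κ] (w : ℕ) :
    (Fintype.card κ).choose w * (Fintype.card 𝔽 - 1) ^ w ≤ (hammingBall 𝔽 κ w).card := by
  classical
  let A : Finset κ → Finset (κ → 𝔽) := fun s =>
    Fintype.piFinset fun i => if i ∈ s then Finset.univ.erase 0 else {0}
  have hA : ∀ s, ∀ e ∈ A s, (Finset.univ.filter fun i => e i ≠ 0) = s := by
    intro s e he
    ext i
    have := Fintype.mem_piFinset.1 he i
    by_cases hi : i ∈ s <;> simp_all
  have hcard : ∀ s ∈ Finset.powersetCard w Finset.univ, (A s).card = (Fintype.card 𝔽 - 1) ^ w := by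
    intro s hs
    rw [Fintype.card_piFinset]
    simp only [apply_ite Finset.card, Finset.card_singleton,
      Finset.card_erase_of_mem (Finset.mem_univ _), Finset.card_univ]
    rw [Finset.prod_ite, Finset.prod_const_one, mul_one, Finset.prod_const, Finset.filter_mem_eq_inter,
      Finset.univ_inter, (Finset.mem_powersetCard.1 hs).2]
  have hdisj : (Finset.powersetCard w (Finset.univ : Finset κ) : Set (Finset κ)).PairwiseDisjoint
      A := by
    intro s _ t _ hst
    refine Finset.disjoint_left.2 fun e hs ht => hst ?_
    rw [← hA s e hs, hA t e ht]
  rw [← Finset.card_univ, ← Finset.card_powersetCard, ← smul_eq_mul, ← Finset.sum_const,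
    ← Finset.sum_congr rfl hcard, ← Finset.card_biUnion hdisj]
  refine Finset.card_le_card fun e he => ?_
  obtain ⟨s, hs, hes⟩ := Finset.mem_biUnion.1 he
  refine Finset.mem_filter.2 ⟨Finset.mem_univ _, ?_⟩
  have : hammingNorm e = s.card := by rw [← hA s e hes]; rfl
  rw [this, (Finset.mem_powersetCard.1 hs).2]

/-- The mode of the binomial distribution with parameters `w + v` and `w / (w + v)` is `w`. -/
theorem choose_mul_pow_mul_pow_le (w v : ℕ) {j : ℕ} (hj : j ≤ w + v) :
    (w + v).choose j * w ^ j * v ^ (w + v - j) ≤ (w + v).choose w * w ^ w * v ^ v := by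
  -- The ratio of the terms `i + 1` and `i` is `(w + v - i) w / ((i + 1) v)`.
  have ratio : ∀ i, i < w + v → ∃ m t, w + v = i + 1 + m ∧
      (i + 1) * ((w + v).choose (i + 1) * w ^ (i + 1) * v ^ (w + v - (i + 1))) =
        t * ((m + 1) * w) ∧
      (i + 1) * ((w + v).choose i * w ^ i * v ^ (w + v - i)) = t * ((i + 1) * v) := by
    intro i hi
    obtain ⟨m, hm⟩ : ∃ m, w + v = i + 1 + m := Nat.exists_eq_add_of_le (by omega)
    have hk := Nat.choose_succ_right_eq (w + v) i
    have h1 : w + v - i = m + 1 := by omega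
    have h2 : w + v - (i + 1) = m := by omega
    rw [h1] at hk
    rw [h1, h2]
    refine ⟨m, (w + v).choose i * w ^ i * v ^ m, hm, ?_, by ring⟩
    calc (i + 1) * ((w + v).choose (i + 1) * w ^ (i + 1) * v ^ m)
        = ((w + v).choose (i + 1) * (i + 1)) * (w ^ i * w * v ^ m) := by rw [pow_succ]; ring
      _ = _ := by rw [hk]; ring
  rcases le_total j w with h | h
  · induction h using Nat.decreasingInduction with
    | self => rw [Nat.add_sub_cancel_left]
    | of_succ i hi ih =>
      refine le_trans ?_ (ih (by omega))
      obtain ⟨m, t, hm, e1, e2⟩ := ratio i (by omega)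
      refine Nat.le_of_mul_le_mul_left ?_ (Nat.succ_pos i)
      rw [Nat.succ_eq_add_one, e1, e2]
      refine Nat.mul_le_mul_left _ ?_
      calc (i + 1) * v ≤ w * (m + 1) := Nat.mul_le_mul (by omega) (by omega)
        _ = _ := mul_comm _ _
  · induction j, h using Nat.le_induction with
    | base => rw [Nat.add_sub_cancel_left]
    | succ i hi ih =>
      refine le_trans ?_ (ih (by omega))
      obtain ⟨m, t, hm, e1, e2⟩ := ratio i (by omega)
      refine Nat.le_of_mul_le_mul_left ?_ (Nat.succ_pos i)
      rw [Nat.succ_eq_add_one, e1, e2]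
      refine Nat.mul_le_mul_left _ ?_
      calc (m + 1) * w ≤ v * (i + 1) := Nat.mul_le_mul (by omega) (by omega)
        _ = _ := mul_comm _ _

/-- A ball of relative radius `w / n` has volume at least `q ^ (n H_q(w / n)) / (n + 1)`: one of the
`n + 1` terms of the binomial distribution with parameters `n` and `w / n` is at least `1 / (n + 1)`,
and the largest one is that of `w`. -/
theorem exp_le_card_hammingBall {κ : Type*} [Fintype κ] [DecidableEq κ] {q : ℕ}
    (hq : q = Fintype.card 𝔽) {w : ℕ} (hw0 : 0 < w) (hw : w < Fintype.card κ) :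
    Real.exp (Fintype.card κ * Real.qaryEntropy q (w / Fintype.card κ)) ≤
      (Fintype.card κ + 1) * (hammingBall 𝔽 κ w).card := by
  have hq2 : 2 ≤ q := hq ▸ Fintype.one_lt_card
  have hq1 : (2 : ℝ) ≤ q := by exact_mod_cast hq2
  have hB := choose_mul_pow_le_card_hammingBall (𝔽 := 𝔽) (κ := κ) w
  set n := Fintype.card κ
  have hn : (0 : ℝ) < n := by exact_mod_cast hw0.trans hw
  have hwR : (0 : ℝ) < w := by exact_mod_cast hw0
  have hwn : (w : ℝ) < n := by exact_mod_cast hw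
  have hsum : n ^ n ≤ (n + 1) * (n.choose w * w ^ w * (n - w) ^ (n - w)) := by
    calc n ^ n = (w + (n - w)) ^ n := by rw [Nat.add_sub_cancel' hw.le]
      _ = ∑ j ∈ Finset.range (n + 1), n.choose j * w ^ j * (n - w) ^ (n - j) := by
        rw [add_pow]
        exact Finset.sum_congr rfl fun j _ => by push_cast; ring
      _ ≤ ∑ j ∈ Finset.range (n + 1), n.choose w * w ^ w * (n - w) ^ (n - w) :=
        Finset.sum_le_sum fun j hj => by
          have := choose_mul_pow_mul_pow_le w (n - w) (j := j)
          rw [Nat.add_sub_cancel' hw.le] at this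
          exact this (Nat.lt_succ_iff.1 (Finset.mem_range.1 hj))
      _ = _ := by rw [Finset.sum_const, Finset.card_range, smul_eq_mul]
  have hsum' : (n : ℝ) ^ n ≤ (n + 1) * (n.choose w * w ^ w * (n - w) ^ (n - w)) := by
    have : ((n ^ n : ℕ) : ℝ) ≤ (((n + 1) * (n.choose w * w ^ w * (n - w) ^ (n - w)) : ℕ) : ℝ) := by
      exact_mod_cast hsum
    push_cast [Nat.cast_sub hw.le] at this
    exact this
  have hB' : (n.choose w : ℝ) * ((q : ℝ) - 1) ^ w ≤ (hammingBall 𝔽 κ w).card := by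
    have : ((n.choose w * (Fintype.card 𝔽 - 1) ^ w : ℕ) : ℝ) ≤ ((hammingBall 𝔽 κ w).card : ℝ) := by
      exact_mod_cast hB
    rw [← hq] at this
    push_cast [Nat.cast_sub (show 1 ≤ q by omega)] at this
    exact this
  have hexp : Real.exp (n * Real.qaryEntropy q (w / n)) =
      (q - 1 : ℝ) ^ w * n ^ n / (w ^ w * (n - w) ^ (n - w)) := by
    have h1 : (0 : ℝ) < (q - 1 : ℝ) ^ w := pow_pos (by linarith) _
    have h2 : (0 : ℝ) < (n : ℝ) ^ n := pow_pos hn _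
    have h3 : (0 : ℝ) < (w : ℝ) ^ w := pow_pos hwR _
    have h4 : (0 : ℝ) < ((n : ℝ) - w) ^ (n - w) := pow_pos (by linarith) _
    rw [← Real.exp_log (div_pos (mul_pos h1 h2) (mul_pos h3 h4)),
      Real.log_div (mul_pos h1 h2).ne' (mul_pos h3 h4).ne', Real.log_mul h1.ne' h2.ne',
      Real.log_mul h3.ne' h4.ne', Real.log_pow, Real.log_pow, Real.log_pow, Real.log_pow,
      Nat.cast_sub hw.le, qaryEntropy_eq_neg hq2 (div_pos hwR hn)]
    have h5 : (1 : ℝ) - w / n = (n - w) / n := by field_simp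
    rw [h5, Real.log_div (div_pos hwR hn).ne' (by linarith), Real.log_div hwR.ne' hn.ne',
      Real.log_div (by linarith) hn.ne']
    congr 1
    field_simp
    ring
  rw [hexp, div_le_iff₀ (mul_pos (pow_pos hwR _) (pow_pos (by linarith) _))]
  calc (q - 1 : ℝ) ^ w * n ^ n
      ≤ (q - 1 : ℝ) ^ w * ((n + 1) * (n.choose w * w ^ w * (n - w) ^ (n - w))) := by
        gcongr
        exact pow_nonneg (by linarith) _
    _ = (n + 1) * (n.choose w * (q - 1 : ℝ) ^ w) * (w ^ w * (n - w) ^ (n - w)) := by ring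
    _ ≤ _ := by
        have : (0 : ℝ) ≤ ((n : ℝ) - w) ^ (n - w) := pow_nonneg (by linarith) _
        gcongr

end Volume

/-! ### Covering matrices: existence -/

/-- The code with parity-check matrix `D` has covering radius at most `ρ`: every syndrome is that of
a vector of Hamming weight at most `ρ`. -/
def Covers {𝔽 : Type*} [Field 𝔽] [DecidableEq 𝔽] {ι κ : Type*} [Fintype κ]
    (D : Matrix ι κ 𝔽) (ρ : ℕ) : Prop :=
  ∀ s : ι → 𝔽, ∃ e : κ → 𝔽, hammingNorm e ≤ ρ ∧ D.mulVec e = s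

/-- The matrix `D` with the column `v` appended. -/
def Matrix.snocCol {𝔽 ι : Type*} {n : ℕ} (D : Matrix ι (Fin n) 𝔽) (v : ι → 𝔽) :
    Matrix ι (Fin (n + 1)) 𝔽 :=
  Matrix.of fun i => Fin.snoc (α := fun _ => 𝔽) (D i) (v i)

section Existence

variable {𝔽 : Type*} [Field 𝔽]

theorem Matrix.snocCol_mulVec_snoc {ι : Type*} {n : ℕ} (D : Matrix ι (Fin n) 𝔽) (v : ι → 𝔽)
    (e : Fin n → 𝔽) (c : 𝔽) :
    (D.snocCol v).mulVec (Fin.snoc (α := fun _ => 𝔽) e c) = D.mulVec e + c • v := by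
  ext i
  simp [Matrix.mulVec, dotProduct, Matrix.snocCol, Fin.sum_univ_castSucc, mul_comm]

variable [DecidableEq 𝔽]

theorem hammingNorm_snoc_le {n : ℕ} (e : Fin n → 𝔽) (c : 𝔽) :
    hammingNorm (Fin.snoc (α := fun _ => 𝔽) e c) ≤ hammingNorm e + 1 := by
  simp only [hammingNorm, Finset.card_filter, Fin.sum_univ_castSucc, Fin.snoc_castSucc,
    Fin.snoc_last]
  gcongr
  split_ifs <;> simp

variable [Fintype 𝔽]

/-- A uniformly random matrix maps a given nonzero vector to a uniformly random vector. -/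
theorem card_mulVec_eq_zero_mul {ι κ : Type*} [Fintype ι] [Fintype κ] [DecidableEq ι]
    [DecidableEq κ] {x : κ → 𝔽} (hx : x ≠ 0) :
    (Finset.univ.filter fun D : Matrix ι κ 𝔽 => D.mulVec x = 0).card * Fintype.card (ι → 𝔽) =
      Fintype.card (Matrix ι κ 𝔽) := by
  obtain ⟨j, hj⟩ := Function.ne_iff.1 hx
  let f : Matrix ι κ 𝔽 →+ (ι → 𝔽) :=
    { toFun := fun D => D.mulVec x
      map_zero' := Matrix.zero_mulVec x
      map_add' := fun A B => Matrix.add_mulVec A B x }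
  have hf : Function.Surjective f := by
    intro s
    refine ⟨Matrix.vecMulVec s (Pi.single j (x j)⁻¹), ?_⟩
    show (Matrix.vecMulVec s (Pi.single j (x j)⁻¹)).mulVec x = s
    ext i
    have hj' : x j ≠ 0 := hj
    simp [Matrix.mulVec, dotProduct, Matrix.vecMulVec_apply, Pi.single_apply, hj', mul_assoc]
  have hfib : ∀ s ∈ (Finset.univ : Finset (ι → 𝔽)),
      (Finset.univ.filter fun D => f D = s).card = (Finset.univ.filter fun D => f D = 0).card :=
    fun s _ => AddMonoidHom.card_fiber_eq_of_mem_range f (hf s) (hf 0)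
  have := Finset.card_eq_sum_card_fiberwise (f := f) (s := Finset.univ) (t := Finset.univ)
    (fun _ _ => Finset.mem_coe.2 (Finset.mem_univ _))
  rw [Finset.sum_congr rfl hfib, Finset.sum_const, smul_eq_mul, Finset.card_univ, Finset.card_univ,
    mul_comm] at this
  exact this.symm

theorem sq_card_le_card_image_mul {α β : Type*} [DecidableEq β] (B : Finset α) (f : α → β) :
    B.card ^ 2 ≤ (B.image f).card * ∑ a ∈ B, (B.filter fun a' => f a' = f a).card := by
  rw [Finset.sum_comp (fun b => (B.filter fun a' => f a' = b).card) f,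
    Finset.card_eq_sum_card_image f B]
  refine (sq_sum_le_card_mul_sum_sq).trans_eq ?_
  simp only [sq, smul_eq_mul, Nat.cast_id]

/-- If a set `B` of vectors is at least as large as the space of syndromes, then some matrix maps it
onto at least half of that space. On average over all matrices, few pairs of vectors of `B` have
the same syndrome; the Cauchy-Schwarz inequality turns this into a bound for the image. -/
theorem exists_card_le_two_mul_card_image {ι κ : Type*} [Fintype ι] [Fintype κ] [DecidableEq ι]
    [DecidableEq κ] (B : Finset (κ → 𝔽)) (hB : Fintype.card (ι → 𝔽) ≤ B.card) :
    ∃ D : Matrix ι κ 𝔽, Fintype.card (ι → 𝔽) ≤ 2 * (B.image D.mulVec).card := by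
  set Q := Fintype.card (ι → 𝔽)
  have hQ : 0 < Q := Fintype.card_pos
  let coll : Matrix ι κ 𝔽 → ℕ := fun D =>
    ∑ a ∈ B, (B.filter fun a' => D.mulVec a' = D.mulVec a).card
  have hpair : ∀ a ∈ B, ∑ a' ∈ B, Q * (Finset.univ.filter fun D : Matrix ι κ 𝔽 =>
      D.mulVec a' = D.mulVec a).card ≤ (Q + B.card) * Fintype.card (Matrix ι κ 𝔽) := by
    intro a ha
    rw [← Finset.add_sum_erase _ _ ha, add_mul]
    refine Nat.add_le_add (Nat.mul_le_mul_left _ (Finset.card_le_univ _)) ?_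
    calc _ = ∑ a' ∈ B.erase a, Fintype.card (Matrix ι κ 𝔽) := by
          refine Finset.sum_congr rfl fun a' ha' => ?_
          rw [← card_mulVec_eq_zero_mul (sub_ne_zero.2 (Finset.ne_of_mem_erase ha')), mul_comm]
          simp only [Matrix.mulVec_sub, sub_eq_zero, Q]
      _ ≤ _ := by
          rw [Finset.sum_const, smul_eq_mul]
          exact Nat.mul_le_mul_right _ (Finset.card_le_card (Finset.erase_subset _ _))
  have hsum : ∑ D, Q * coll D ≤ ∑ _D : Matrix ι κ 𝔽, B.card * (Q + B.card) := by
    calc ∑ D, Q * coll D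
        = ∑ a ∈ B, ∑ a' ∈ B, Q * (Finset.univ.filter fun D : Matrix ι κ 𝔽 =>
            D.mulVec a' = D.mulVec a).card := by
          simp only [coll, Finset.mul_sum, Finset.card_filter]
          rw [Finset.sum_comm]
          exact Finset.sum_congr rfl fun a _ => Finset.sum_comm
      _ ≤ ∑ a ∈ B, (Q + B.card) * Fintype.card (Matrix ι κ 𝔽) := Finset.sum_le_sum hpair
      _ = _ := by
          rw [Finset.sum_const, Finset.sum_const, smul_eq_mul, smul_eq_mul, Finset.card_univ]
          ring
  obtain ⟨D, -, hD⟩ := Finset.exists_le_of_sum_le Finset.univ_nonempty hsum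
  refine ⟨D, ?_⟩
  have hcs : B.card ^ 2 ≤ (B.image D.mulVec).card * coll D := sq_card_le_card_image_mul B D.mulVec
  have hB0 : 0 < B.card ^ 2 := pow_pos (hQ.trans_le hB) 2
  refine Nat.le_of_mul_le_mul_left ?_ hB0
  calc B.card ^ 2 * Q ≤ ((B.image D.mulVec).card * coll D) * Q := Nat.mul_le_mul_right _ hcs
    _ = (B.image D.mulVec).card * (Q * coll D) := by ring
    _ ≤ (B.image D.mulVec).card * (B.card * (Q + B.card)) := Nat.mul_le_mul_left _ hD
    _ ≤ (B.image D.mulVec).card * (B.card * (B.card + B.card)) := by gcongr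
    _ = B.card ^ 2 * (2 * (B.image D.mulVec).card) := by ring

/-- Some translate of a set `U` meets `U` in no larger a proportion than independent sets would. -/
theorem exists_card_filter_sub_mem_mul_le {G : Type*} [AddCommGroup G] [Fintype G] [DecidableEq G]
    (U : Finset G) :
    ∃ v : G, (U.filter fun s => s - v ∈ U).card * Fintype.card G ≤ U.card ^ 2 := by
  have hsum : ∑ v : G, (U.filter fun s => s - v ∈ U).card * Fintype.card G ≤
      ∑ _v : G, U.card ^ 2 := by
    rw [← Finset.sum_mul, Finset.sum_const, Finset.card_univ, smul_eq_mul, mul_comm]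
    refine Nat.mul_le_mul_left _ ?_
    simp only [Finset.card_filter]
    rw [Finset.sum_comm, sq, ← smul_eq_mul, ← Finset.sum_const]
    refine Finset.sum_le_sum fun s _ => ?_
    rw [← Finset.card_filter]
    exact Finset.card_le_card_of_injOn (fun v => s - v) (fun v hv => (Finset.mem_filter.1 hv).2)
      (fun v _ w _ h => sub_right_injective h)
  obtain ⟨v, -, hv⟩ := Finset.exists_le_of_sum_le Finset.univ_nonempty hsum
  exact ⟨v, hv⟩

/-- Each appended column, if chosen suitably, squares the proportion of syndromes that do not come from
vectors of small weight: a bound `1 / 2` becomes `1 / 2 ^ 2 ^ j` after `j` columns. -/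
theorem exists_snocCol_iterate {k n : ℕ} (D : Matrix (Fin k) (Fin n) 𝔽) (w : ℕ)
    {U : Finset (Fin k → 𝔽)} (hU : ∀ s ∉ U, ∃ e : Fin n → 𝔽, hammingNorm e ≤ w ∧ D.mulVec e = s)
    (hcard : 2 * U.card ≤ Fintype.card (Fin k → 𝔽)) (j : ℕ) :
    ∃ (D' : Matrix (Fin k) (Fin (n + j)) 𝔽) (U' : Finset (Fin k → 𝔽)),
      (∀ s ∉ U', ∃ e : Fin (n + j) → 𝔽, hammingNorm e ≤ w + j ∧ D'.mulVec e = s) ∧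
      2 ^ 2 ^ j * U'.card ≤ Fintype.card (Fin k → 𝔽) := by
  induction j with
  | zero => exact ⟨D, U, hU, by simpa using hcard⟩
  | succ j ih =>
    obtain ⟨D', U', h1, h2⟩ := ih
    obtain ⟨v, hv⟩ := exists_card_filter_sub_mem_mul_le U'
    refine ⟨D'.snocCol v, U'.filter fun s => s - v ∈ U', fun s hs => ?_, ?_⟩
    · have hs' : s ∉ U' ∨ s - v ∉ U' := by
        by_contra! h
        exact hs (Finset.mem_filter.2 h)
      rcases hs' with hs' | hs'
      · obtain ⟨e, he, hes⟩ := h1 s hs'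
        refine ⟨Fin.snoc (α := fun _ => 𝔽) e 0, (hammingNorm_snoc_le e 0).trans
          (Nat.succ_le_succ he), ?_⟩
        rw [Matrix.snocCol_mulVec_snoc, hes, zero_smul, add_zero]
      · obtain ⟨e, he, hes⟩ := h1 _ hs'
        refine ⟨Fin.snoc (α := fun _ => 𝔽) e 1, (hammingNorm_snoc_le e 1).trans
          (Nat.succ_le_succ he), ?_⟩
        rw [Matrix.snocCol_mulVec_snoc, hes, one_smul, sub_add_cancel]
    · have hQ : 0 < Fintype.card (Fin k → 𝔽) := Fintype.card_pos
      refine Nat.le_of_mul_le_mul_right ?_ hQ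
      calc 2 ^ 2 ^ (j + 1) * (U'.filter fun s => s - v ∈ U').card * Fintype.card (Fin k → 𝔽)
          = 2 ^ 2 ^ (j + 1) * ((U'.filter fun s => s - v ∈ U').card * Fintype.card (Fin k → 𝔽)) :=
            mul_assoc _ _ _
        _ ≤ 2 ^ 2 ^ (j + 1) * U'.card ^ 2 := Nat.mul_le_mul_left _ hv
        _ = (2 ^ 2 ^ j * U'.card) * (2 ^ 2 ^ j * U'.card) := by
            rw [pow_succ 2 j, pow_mul]; ring
        _ ≤ _ := Nat.mul_le_mul h2 h2

/-- If the ball of radius `w` in `𝔽 ^ n` is as large as the space `𝔽 ^ k` of syndromes, then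
`j = O(log k)` further columns suffice for a matrix of covering radius at most `w + j`. -/
theorem exists_covers_of_card_le_card_hammingBall {k n w j : ℕ}
    (hB : Fintype.card 𝔽 ^ k ≤ (hammingBall 𝔽 (Fin n) w).card)
    (hj : Fintype.card 𝔽 ^ k < 2 ^ 2 ^ j) :
    ∃ D : Matrix (Fin k) (Fin (n + j)) 𝔽, Covers D (w + j) := by
  have hQ : Fintype.card (Fin k → 𝔽) = Fintype.card 𝔽 ^ k := by simp
  obtain ⟨D, hD⟩ := exists_card_le_two_mul_card_image (ι := Fin k) _ (hQ.trans_le hB)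
  set S := (hammingBall 𝔽 (Fin n) w).image D.mulVec with hS
  have hU : ∀ s ∉ Sᶜ, ∃ e : Fin n → 𝔽, hammingNorm e ≤ w ∧ D.mulVec e = s := by
    intro s hs
    rw [Finset.notMem_compl, hS, Finset.mem_image] at hs
    obtain ⟨e, he, hes⟩ := hs
    exact ⟨e, (Finset.mem_filter.1 he).2, hes⟩
  have hc : 2 * Sᶜ.card ≤ Fintype.card (Fin k → 𝔽) := by
    have := Finset.card_add_card_compl S
    omega
  obtain ⟨D', U', h1, h2⟩ := exists_snocCol_iterate D w hU hc j
  refine ⟨D', fun s => h1 s fun hs => ?_⟩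
  have : 2 ^ 2 ^ j * 1 ≤ 2 ^ 2 ^ j * U'.card :=
    Nat.mul_le_mul_left _ (Finset.card_pos.2 ⟨s, hs⟩)
  rw [hQ] at h2
  omega

end Existence

/-! ### Covering matrices: constructions -/

/-- The number of nonzero entries of a matrix. -/
def Matrix.weight {𝔽 : Type*} [Field 𝔽] [DecidableEq 𝔽] {ι κ : Type*} [Fintype ι] [Fintype κ]
    (D : Matrix ι κ 𝔽) : ℕ :=
  ∑ i, hammingNorm (D i)

section Constructions

variable {𝔽 : Type*} [Field 𝔽] [DecidableEq 𝔽]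

theorem hammingNorm_comp_equiv {κ κ' : Type*} [Fintype κ] [Fintype κ'] (f : κ ≃ κ')
    (e : κ' → 𝔽) : hammingNorm (fun j => e (f j)) = hammingNorm e := by
  simp only [hammingNorm, Finset.card_filter]
  exact Equiv.sum_comp f fun j => if e j ≠ 0 then 1 else 0

theorem hammingNorm_extend_le {κ κ' : Type*} [Fintype κ] [Fintype κ'] (f : κ ↪ κ')
    (e : κ → 𝔽) : hammingNorm (Function.extend f e 0) ≤ hammingNorm e := by
  rw [hammingNorm, hammingNorm, ← Finset.card_map f]
  refine Finset.card_le_card fun j hj => ?_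
  have hj' := (Finset.mem_filter.1 hj).2
  by_cases h : ∃ i, f i = j
  · obtain ⟨i, rfl⟩ := h
    rw [f.injective.extend_apply] at hj'
    exact Finset.mem_map_of_mem f (Finset.mem_filter.2 ⟨Finset.mem_univ _, hj'⟩)
  · exact absurd (Function.extend_apply' e (0 : κ' → 𝔽) j h) hj'

theorem hammingNorm_sigma {o : Type*} [Fintype o] {κ : o → Type*} [∀ i, Fintype (κ i)]
    (e : (Σ i, κ i) → 𝔽) : hammingNorm e = ∑ i, hammingNorm fun j => e ⟨i, j⟩ := by
  simp only [hammingNorm, Finset.card_filter]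
  exact Fintype.sum_sigma _

theorem Matrix.weight_submatrix_equiv {ι ι' κ κ' : Type*} [Fintype ι] [Fintype ι'] [Fintype κ]
    [Fintype κ'] (D : Matrix ι κ 𝔽) (g : ι' ≃ ι) (f : κ' ≃ κ) :
    (D.submatrix g f).weight = D.weight := by
  unfold Matrix.weight
  rw [← Equiv.sum_comp g]
  exact Finset.sum_congr rfl fun i _ => hammingNorm_comp_equiv f (D (g i))

theorem Covers.submatrix_equiv {ι ι' κ κ' : Type*} [Fintype κ] [Fintype κ']
    {D : Matrix ι κ 𝔽} {ρ : ℕ} (h : Covers D ρ) (g : ι' ≃ ι) (f : κ' ≃ κ) :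
    Covers (D.submatrix g f) ρ := by
  intro s
  obtain ⟨e, he, hs⟩ := h (s ∘ g.symm)
  refine ⟨e ∘ f, (hammingNorm_comp_equiv f e).trans_le he, ?_⟩
  rw [Matrix.submatrix_mulVec_equiv, Function.comp_assoc, Equiv.self_comp_symm,
    Function.comp_id, hs, Function.comp_assoc, Equiv.symm_comp_self, Function.comp_id]

/-- Deleting rows and adding columns preserves the covering property. -/
theorem Covers.exists_of_embedding {ι ι' κ κ' : Type*} [Fintype κ] [Fintype κ']
    {D : Matrix ι κ 𝔽} {ρ : ℕ} (h : Covers D ρ) (g : ι' ↪ ι) (f : κ ↪ κ') :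
    ∃ D' : Matrix ι' κ' 𝔽, Covers D' ρ := by
  refine ⟨Matrix.of fun i => Function.extend f (D (g i)) 0, fun s => ?_⟩
  obtain ⟨e, he, hs⟩ := h (Function.extend g s 0)
  refine ⟨Function.extend f e 0, (hammingNorm_extend_le f e).trans he, ?_⟩
  ext i
  have := congrFun hs (g i)
  rw [g.injective.extend_apply] at this
  rw [← this]
  refine (Fintype.sum_of_injective f f.injective _ _ (fun j hj => ?_) fun j => ?_).symm
  · show Function.extend f (D (g i)) 0 j * Function.extend f e 0 j = 0
    rw [Function.extend_apply' e _ _ hj, Pi.zero_apply, mul_zero]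
  · show D (g i) j * e j = Function.extend f (D (g i)) 0 (f j) * Function.extend f e 0 (f j)
    rw [f.injective.extend_apply, f.injective.extend_apply]

theorem Covers.blockDiagonal' {o : Type*} [Fintype o] [DecidableEq o] {ι κ : o → Type*}
    [∀ i, Fintype (κ i)] {D : ∀ i, Matrix (ι i) (κ i) 𝔽} {ρ : o → ℕ}
    (h : ∀ i, Covers (D i) (ρ i)) : Covers (Matrix.blockDiagonal' D) (∑ i, ρ i) := by
  intro s
  choose e he hs using fun i => h i fun a => s ⟨i, a⟩
  refine ⟨fun j => e j.1 j.2, ?_, ?_⟩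
  · rw [hammingNorm_sigma]
    exact Finset.sum_le_sum fun i _ => he i
  · ext ⟨i, a⟩
    rw [← congrFun (hs i) a]
    simp only [Matrix.mulVec, dotProduct]
    rw [Fintype.sum_sigma, Finset.sum_eq_single i]
    · exact Finset.sum_congr rfl fun b _ => by rw [Matrix.blockDiagonal'_apply_eq]
    · intro i' _ hi
      exact Finset.sum_eq_zero fun b _ => by
        rw [Matrix.blockDiagonal'_apply_ne _ _ _ hi.symm, zero_mul]
    · exact fun hi => absurd (Finset.mem_univ i) hi

/-- One more column makes a covering matrix dense. For every scalar `a`, adding `a` to all entries of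
`D` and appending a column of entries `a` gives a matrix that covers, since the new coordinate can
be chosen so as to cancel the contribution of `a`. For `a = 0` or for `a = 1` at least half of
the entries are nonzero. -/
theorem Covers.exists_dense {ι : Type*} [Fintype ι] {n ρ : ℕ} {D : Matrix ι (Fin n) 𝔽}
    (h : Covers D ρ) :
    ∃ D' : Matrix ι (Fin (n + 1)) 𝔽, Covers D' (ρ + 1) ∧
      Fintype.card ι * (n + 1) ≤ 2 * D'.weight := by
  let M : 𝔽 → Matrix ι (Fin (n + 1)) 𝔽 := fun a =>
    Matrix.snocCol (Matrix.of fun i j => D i j + a) fun _ => a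
  have hM : ∀ a, Covers (M a) (ρ + 1) := by
    intro a s
    obtain ⟨e, he, hs⟩ := h s
    refine ⟨Fin.snoc (α := fun _ => 𝔽) e (-∑ j, e j),
      (hammingNorm_snoc_le _ _).trans (Nat.succ_le_succ he), ?_⟩
    rw [Matrix.snocCol_mulVec_snoc, ← hs]
    ext i
    simp only [Matrix.mulVec, dotProduct, Matrix.of_apply, Pi.add_apply, Pi.smul_apply, smul_eq_mul,
      neg_mul, Finset.sum_mul]
    rw [← sub_eq_add_neg, ← Finset.sum_sub_distrib]
    exact Finset.sum_congr rfl fun j _ => by ring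
  have hw : Fintype.card ι * (n + 1) ≤ (M 0).weight + (M 1).weight := by
    rw [Matrix.weight, Matrix.weight, ← Finset.sum_add_distrib, ← Finset.card_univ, ← smul_eq_mul]
    refine Finset.card_nsmul_le_sum _ _ _ fun i _ => ?_
    simp only [hammingNorm, Finset.card_filter]
    rw [← Finset.sum_add_distrib]
    calc n + 1 = ∑ _j : Fin (n + 1), 1 := by simp
      _ ≤ _ := Finset.sum_le_sum fun j _ => by
        refine Fin.lastCases ?_ (fun j => ?_) j
        · simp [M, Matrix.snocCol]
        · by_cases h0 : D i j = 0 <;> simp [M, Matrix.snocCol, h0]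
  rcases le_total (M 0).weight (M 1).weight with hle | hle
  · exact ⟨M 1, hM 1, by omega⟩
  · exact ⟨M 0, hM 0, by omega⟩

end Constructions

/-! ### Covering matrices: asymptotics -/

section Asymptotics

variable {𝔽 : Type*} [Field 𝔽] [DecidableEq 𝔽] [Fintype 𝔽]

/-- If `R < H_q(δ)`, then a matrix with ratio of rows to columns above `R` can have relative covering
radius at most `δ + η`. -/
theorem exists_covers_of_lt_entropyQ {q : ℕ} (hq : q = Fintype.card 𝔽) {R δ η : ℝ} (hR : 0 < R)
    (hδ : δ ∈ Set.Ioo (0 : ℝ) 1) (hRδ : R < entropyQ q δ) (hη : 0 < η) :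
    ∃ (k n ρ : ℕ) (D : Matrix (Fin k) (Fin n) 𝔽), Covers D ρ ∧ 0 < n ∧ R * n < k ∧
      (ρ : ℝ) ≤ (δ + η) * n := by
  have hq2 : 2 ≤ q := hq ▸ Fintype.one_lt_card
  have hq1 : (2 : ℝ) ≤ q := by exact_mod_cast hq2
  have hl : 0 < Real.log q := Real.log_pos (by linarith)
  obtain ⟨R', hR1, hR2⟩ := exists_between hRδ
  -- Everything is evaluated along `n = 2 ^ i`, with `i + q` further columns.
  have hpow : Tendsto (fun i : ℕ => 2 ^ i) atTop (atTop : Filter ℕ) :=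
    tendsto_pow_atTop_atTop_of_one_lt one_lt_two
  have hx : Tendsto (fun n : ℕ => (⌊δ * n⌋₊ : ℝ) / n) atTop (𝓝 δ) :=
    (tendsto_nat_floor_mul_div_atTop hδ.1.le).comp tendsto_natCast_atTop_atTop
  have hH : Tendsto (fun n : ℕ => Real.qaryEntropy q ((⌊δ * n⌋₊ : ℝ) / n)) atTop
      (𝓝 (Real.qaryEntropy q δ)) := (Real.qaryEntropy_continuous.tendsto δ).comp hx
  have hlog : Tendsto (fun n : ℕ => Real.log ((n : ℝ) + 1) / n) atTop (𝓝 0) := by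
    have h1 : Tendsto (fun x : ℝ => Real.log (x + 1) - Real.log x) atTop (𝓝 0) :=
      Real.tendsto_log_comp_add_sub_log 1
    have h2 : Tendsto (fun x : ℝ => Real.log x / x) atTop (𝓝 0) :=
      Real.isLittleO_log_id_atTop.tendsto_div_nhds_zero
    have h3 : Tendsto (fun x : ℝ => (Real.log (x + 1) - Real.log x) / x + Real.log x / x) atTop
        (𝓝 0) := by
      simpa using (h1.div_atTop tendsto_id).add h2
    refine (h3.comp tendsto_natCast_atTop_atTop).congr fun n => ?_
    simp only [Function.comp_apply]
    rw [← add_div, sub_add_cancel]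
  have hvol : ∀ᶠ n : ℕ in atTop, R' * Real.log q <
      Real.qaryEntropy q ((⌊δ * n⌋₊ : ℝ) / n) - Real.log ((n : ℝ) + 1) / n := by
    have := hH.sub hlog
    rw [sub_zero, ← entropyQ_mul_log hq2] at this
    exact this.eventually (lt_mem_nhds (mul_lt_mul_of_pos_right hR2 hl))
  have hj : Tendsto (fun i : ℕ => ((i + q : ℕ) : ℝ) / ((2 ^ i : ℕ) : ℝ)) atTop (𝓝 0) := by
    have h1 := tendsto_pow_const_div_const_pow_of_one_lt 1 (one_lt_two : (1 : ℝ) < 2)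
    have h2 := (tendsto_pow_const_div_const_pow_of_one_lt 0 (one_lt_two : (1 : ℝ) < 2)).const_mul
      (q : ℝ)
    have := h1.add h2
    rw [mul_zero, add_zero] at this
    refine this.congr fun i => ?_
    push_cast
    ring
  have hinv : Tendsto (fun i : ℕ => (1 : ℝ) / ((2 ^ i : ℕ) : ℝ)) atTop (𝓝 0) :=
    tendsto_one_div_atTop_nhds_zero_nat.comp hpow
  have hk : ∀ᶠ i : ℕ in atTop, R * (((i + q : ℕ) : ℝ) / ((2 ^ i : ℕ) : ℝ)) +
      1 / ((2 ^ i : ℕ) : ℝ) < R' - R := by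
    have := (hj.const_mul R).add hinv
    rw [mul_zero, add_zero] at this
    exact this.eventually (gt_mem_nhds (sub_pos.2 hR1))
  obtain ⟨i, hi1, hi2, hi3, hi4, hi5⟩ := ((hpow.eventually hvol).and
    ((hpow.eventually (hx.eventually (lt_mem_nhds hδ.1))).and
    ((hpow.eventually (hx.eventually (gt_mem_nhds hδ.2))).and
    (hk.and (hj.eventually (gt_mem_nhds hη)))))).exists
  have hn0 : 0 < 2 ^ i := Nat.two_pow_pos i
  generalize hn : 2 ^ i = n at *
  have hnR : (0 : ℝ) < n := by exact_mod_cast hn0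
  set w := ⌊δ * n⌋₊ with hw
  have hw0 : 0 < w := by
    rw [div_pos_iff_of_pos_right hnR] at hi2
    exact_mod_cast hi2
  have hwn : w < n := by
    rw [div_lt_one hnR] at hi3
    exact_mod_cast hi3
  have hvolume := exp_le_card_hammingBall (𝔽 := 𝔽) (κ := Fin n) hq hw0 (by simpa using hwn)
  rw [Fintype.card_fin] at hvolume
  have hB : (q : ℝ) ^ ⌊R' * n⌋₊ ≤ (hammingBall 𝔽 (Fin n) w).card := by
    have h1 : (q : ℝ) ^ ⌊R' * n⌋₊ ≤ Real.exp (R' * Real.log q * n) := by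
      rw [← Real.exp_log (pow_pos (by linarith : (0 : ℝ) < q) _), Real.exp_le_exp, Real.log_pow]
      have := Nat.floor_le (mul_nonneg (hR.trans hR1).le hnR.le)
      nlinarith
    have h2 : Real.exp (R' * Real.log q * n) * (n + 1) ≤
        Real.exp (n * Real.qaryEntropy q (w / n)) := by
      nth_rewrite 1 [← Real.exp_log (by linarith : (0 : ℝ) < (n : ℝ) + 1)]
      rw [← Real.exp_add, Real.exp_le_exp]
      have := mul_le_mul_of_nonneg_right hi1.le hnR.le
      rw [sub_mul, div_mul_cancel₀ _ hnR.ne'] at this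
      linarith
    refine h1.trans (le_of_mul_le_mul_right ?_ (by linarith : (0 : ℝ) < (n : ℝ) + 1))
    linarith
  have hB' : Fintype.card 𝔽 ^ ⌊R' * n⌋₊ ≤ (hammingBall 𝔽 (Fin n) w).card := by
    rw [← hq]
    exact_mod_cast hB
  have hcols : Fintype.card 𝔽 ^ ⌊R' * n⌋₊ < 2 ^ 2 ^ (i + q) := by
    calc Fintype.card 𝔽 ^ ⌊R' * n⌋₊ ≤ Fintype.card (Fin n → 𝔽) := hB'.trans (Finset.card_le_univ _)
      _ = q ^ n := by rw [Fintype.card_fun, Fintype.card_fin, hq]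
      _ < (2 ^ 2 ^ q) ^ n := Nat.pow_lt_pow_left
          (Nat.lt_two_pow_self.trans (Nat.pow_lt_pow_right one_lt_two Nat.lt_two_pow_self)) hn0.ne'
      _ = 2 ^ 2 ^ (i + q) := by rw [← hn, ← pow_mul, ← pow_add, add_comm]
  obtain ⟨D, hD⟩ := exists_covers_of_card_le_card_hammingBall hB' hcols
  refine ⟨_, _, _, D, hD, by omega, ?_, ?_⟩
  · have h1 := Nat.lt_floor_add_one (R' * n)
    rw [mul_div_assoc', ← add_div, div_lt_iff₀ hnR] at hi4
    push_cast at hi4 ⊢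
    linarith
  · have h1 : (w : ℝ) ≤ δ * n := Nat.floor_le (mul_nonneg hδ.1.le hnR.le)
    rw [div_lt_iff₀ hnR] at hi5
    have h2 : (0 : ℝ) ≤ (δ + η) * (i + q : ℕ) :=
      mul_nonneg (add_pos hδ.1 hη).le (Nat.cast_nonneg _)
    push_cast at hi5 h2 ⊢
    linarith

/-- All large `n` admit dense matrices with `n` columns and up to `R' n` rows, for some `R' > R`, whose
relative covering radius is at most `H_q⁻¹(R) + η`: direct sums of copies of one good matrix. -/
theorem exists_eventually_covers {q : ℕ} (hq : q = Fintype.card 𝔽) {R η : ℝ}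
    (hR : R ∈ Set.Ioo (0 : ℝ) 1) (hη : 0 < η) :
    ∃ R' > R, ∀ᶠ n : ℕ in atTop, ∀ (ι κ : Type) [Fintype ι] [Fintype κ], Fintype.card κ = n →
      (Fintype.card ι : ℝ) ≤ R' * n → ∃ (D : Matrix ι κ 𝔽) (ρ : ℕ), Covers D ρ ∧
        (ρ : ℝ) ≤ (entropyQInv q R + η) * n ∧ Fintype.card ι * n ≤ 2 * D.weight := by
  have hq2 : 2 ≤ q := hq ▸ Fintype.one_lt_card
  set h := entropyQInv q R
  have hh0 : 0 < h := entropyQInv_pos hq2 hR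
  have hh1 : h < 1 - 1 / (q : ℝ) := entropyQInv_lt hq2 hR
  obtain ⟨δ, hδ1, hδ2⟩ := exists_between (lt_min hh1 (lt_add_of_pos_right h (half_pos (half_pos hη))))
  obtain ⟨hδ2, hδ3⟩ := lt_min_iff.1 hδ2
  have hRδ : R < entropyQ q δ := by
    rw [← entropyQ_entropyQInv hq2 (Set.Ioo_subset_Icc_self hR)]
    exact strictMonoOn_entropyQ hq2 ⟨hh0.le, hh1.le⟩ ⟨(hh0.trans hδ1).le, hδ2.le⟩ hδ1
  obtain ⟨k, n₀, ρ, D, hD, hn0, hk, hρ⟩ := exists_covers_of_lt_entropyQ hq hR.1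
    ⟨hh0.trans hδ1, hδ2.trans (one_sub_inv_lt_one hq2)⟩ hRδ (half_pos (half_pos hη))
  have hn0R : (0 : ℝ) < n₀ := by exact_mod_cast hn0
  obtain ⟨R', hR1, hR2⟩ := exists_between ((lt_div_iff₀ hn0R).2 hk)
  refine ⟨R', hR1, ?_⟩
  have hrows : ∀ᶠ n : ℕ in atTop, k / n₀ * (1 + n₀) ≤ (k / n₀ - R') * (n : ℝ) :=
    (tendsto_natCast_atTop_atTop.const_mul_atTop (sub_pos.2 hR2)).eventually_ge_atTop _
  have hrad : ∀ᶠ n : ℕ in atTop, 1 ≤ η / 2 * (n : ℝ) :=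
    (tendsto_natCast_atTop_atTop.const_mul_atTop (half_pos hη)).eventually_ge_atTop _
  filter_upwards [hrows, hrad, eventually_ge_atTop 1] with n h1 h2 h3 ι κ _ _ hκ hι
  obtain ⟨m, rfl⟩ : ∃ m, n = m + 1 := ⟨n - 1, by omega⟩
  set t := m / n₀
  have ht : t * n₀ ≤ m := Nat.div_mul_le_self m n₀
  have ht' : m < t * n₀ + n₀ := Nat.lt_div_mul_add hn0
  have htR : (t : ℝ) * n₀ ≤ m := by exact_mod_cast ht
  have htR' : (m : ℝ) < t * n₀ + n₀ := by exact_mod_cast ht'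
  push_cast at h1 h2 hι
  have hιt : Fintype.card ι ≤ t * k := by
    have h4 : (k / n₀ : ℝ) * (m - n₀) ≤ k / n₀ * (t * n₀) := by
      gcongr
      linarith
    have h5 : (k / n₀ : ℝ) * (t * n₀) = t * k := by field_simp
    have : (Fintype.card ι : ℝ) ≤ t * k := by linarith
    exact_mod_cast this
  have hblock := Covers.blockDiagonal' fun _ : Fin t => hD
  obtain ⟨g⟩ : Nonempty (ι ↪ Σ _ : Fin t, Fin k) :=
    Function.Embedding.nonempty_of_card_le (by simpa using hιt)
  obtain ⟨f⟩ : Nonempty ((Σ _ : Fin t, Fin n₀) ↪ Fin m) :=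
    Function.Embedding.nonempty_of_card_le (by simpa using ht)
  obtain ⟨D₁, hD₁⟩ := hblock.exists_of_embedding g f
  obtain ⟨D₂, hD₂, hw⟩ := hD₁.exists_dense
  have c : κ ≃ Fin (m + 1) := Fintype.equivFinOfCardEq hκ
  refine ⟨D₂.submatrix (Equiv.refl ι) c, _, hD₂.submatrix_equiv _ _, ?_, ?_⟩
  · simp only [Finset.sum_const, Finset.card_univ, Fintype.card_fin, smul_eq_mul]
    push_cast
    have h6 : (t : ℝ) * ρ ≤ t * ((δ + η / 2 / 2) * n₀) := by gcongr
    have h7 : (t : ℝ) * ((δ + η / 2 / 2) * n₀) ≤ (h + η / 2) * m := by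
      calc (t : ℝ) * ((δ + η / 2 / 2) * n₀) = (δ + η / 2 / 2) * (t * n₀) := by ring
        _ ≤ (h + η / 2) * m := by
          exact mul_le_mul (by linarith) htR (by positivity) (by linarith)
    nlinarith
  · rwa [Matrix.weight_submatrix_equiv]

end Asymptotics

/-! ### Block diagonal covering matrices -/

section Blocks

variable {𝔽 : Type*} [Field 𝔽] [DecidableEq 𝔽]

theorem Matrix.weight_blockDiagonal' {o : Type*} [Fintype o] [DecidableEq o] {ι κ : o → Type*}
    [∀ i, Fintype (ι i)] [∀ i, Fintype (κ i)] (D : ∀ i, Matrix (ι i) (κ i) 𝔽) :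
    (Matrix.blockDiagonal' D).weight = ∑ i, (D i).weight := by
  unfold Matrix.weight
  rw [Fintype.sum_sigma]
  refine Finset.sum_congr rfl fun i _ => Finset.sum_congr rfl fun a _ => ?_
  rw [hammingNorm_sigma, Finset.sum_eq_single i]
  · congr 1
    ext b
    exact Matrix.blockDiagonal'_apply_eq D i a b
  · intro i' _ hi
    rw [hammingNorm_eq_zero]
    ext b
    exact Matrix.blockDiagonal'_apply_ne D a b hi.symm
  · exact fun hi => absurd (Finset.mem_univ i) hi

theorem sum_card_fiber {α o : Type*} [Fintype α] [Fintype o] [DecidableEq o] (c : α → o) :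
    ∑ i, Fintype.card {a // c a = i} = Fintype.card α := by
  rw [← Fintype.card_sigma, Fintype.card_congr (Equiv.sigmaFiberEquiv c)]

/-- Covering matrices on the fibers of two labellings, of the rows and of the columns, are the diagonal
blocks of a covering matrix. -/
theorem exists_covers_of_fibers {ι κ o : Type*} [Fintype ι] [Fintype κ] [Fintype o]
    [DecidableEq o] (r : ι → o) (c : κ → o)
    (D : ∀ i, Matrix {k // r k = i} {n // c n = i} 𝔽) {ρ : o → ℕ}
    (h : ∀ i, Covers (D i) (ρ i)) :
    ∃ D' : Matrix ι κ 𝔽, Covers D' (∑ i, ρ i) ∧ D'.weight = ∑ i, (D i).weight ∧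
      ∀ k n, D' k n ≠ 0 → r k = c n := by
  refine ⟨(Matrix.blockDiagonal' D).submatrix (Equiv.sigmaFiberEquiv r).symm
    (Equiv.sigmaFiberEquiv c).symm, (Covers.blockDiagonal' h).submatrix_equiv _ _, ?_, ?_⟩
  · rw [Matrix.weight_submatrix_equiv, Matrix.weight_blockDiagonal']
  · intro k n hkn
    by_contra hne
    exact hkn (Matrix.blockDiagonal'_apply_ne D ⟨k, rfl⟩ ⟨n, rfl⟩ hne)

/-- `Fin N` splits into `N / s` consecutive intervals of length between `s` and `2 s`. -/
theorem exists_monotone_card_fiber {N s : ℕ} (hs : 0 < s) (hsN : s ≤ N) :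
    ∃ c : Fin N → Fin (N / s), Monotone c ∧
      ∀ i, s ≤ Fintype.card {n // c n = i} ∧ Fintype.card {n // c n = i} ≤ 2 * s := by
  have hm : 0 < N / s := Nat.div_pos hsN hs
  have hms : N / s * s ≤ N := Nat.div_mul_le_self N s
  have hms' : N < N / s * s + s := Nat.lt_div_mul_add hs
  set m := N / s
  refine ⟨fun n => ⟨min (n / s) (m - 1), by omega⟩, fun a b hab => ?_, fun i => ⟨?_, ?_⟩⟩
  · exact min_le_min_right _ (Nat.div_le_div_right hab)
  · have hi : (i + 1) * s ≤ m * s := Nat.mul_le_mul_right _ i.2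
    rw [add_mul, one_mul] at hi
    refine (Fintype.card_fin s).symm.trans_le (Fintype.card_le_of_injective
      (fun j : Fin s => ⟨⟨i * s + j, by omega⟩, ?_⟩) fun a b hab => ?_)
    · ext
      have : (i * s + j) / s = i := by
        rw [mul_comm, Nat.mul_add_div hs, Nat.div_eq_of_lt j.2, add_zero]
      simp only [this]
      omega
    · simp only [Subtype.mk.injEq, Fin.mk.injEq] at hab
      exact Fin.ext (by omega)
  · have key : ∀ n : {n : Fin N // (⟨min (n / s) (m - 1), by omega⟩ : Fin m) = i},
        i * s ≤ n.1 ∧ (n.1 : ℕ) < i * s + 2 * s := by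
      intro ⟨n, hn⟩
      have hn' : min ((n : ℕ) / s) (m - 1) = i := congrArg Fin.val hn
      have h1 : (n : ℕ) / s * s ≤ n := Nat.div_mul_le_self n s
      have h2 : (n : ℕ) < n / s * s + s := Nat.lt_div_mul_add hs
      have h3 : i * s ≤ n / s * s := Nat.mul_le_mul_right _ (by omega)
      refine ⟨h3.trans h1, ?_⟩
      rcases le_total ((n : ℕ) / s) (m - 1) with h | h
      · rw [min_eq_left h] at hn'
        rw [hn'] at h2
        show (n : ℕ) < _
        omega
      · rw [min_eq_right h] at hn'
        have h4 : m * s = i * s + s := by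
          rw [← Nat.succ_mul]
          congr 1
          omega
        have := n.2
        show (n : ℕ) < _
        omega
    refine (Fintype.card_le_of_injective (β := Fin (2 * s)) (fun n => ⟨n.1 - i * s, ?_⟩)
      fun a b hab => ?_).trans_eq (Fintype.card_fin _)
    · have := key n
      omega
    · have ha := key a
      have hb := key b
      simp only [Fin.mk.injEq] at hab
      exact Subtype.ext (Fin.ext (by omega))

/-- `Fin K` splits into `m` consecutive intervals of length at most `K / m + 1`. -/
theorem exists_monotone_card_fiber_le (K : ℕ) {m : ℕ} (hm : 0 < m) :
    ∃ r : Fin K → Fin m, Monotone r ∧ ∀ i, Fintype.card {k // r k = i} ≤ K / m + 1 := by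
  set t := K / m + 1
  have hK : K < m * t := Nat.lt_mul_div_succ K hm
  refine ⟨fun k => ⟨k / t, Nat.div_lt_of_lt_mul (by rw [mul_comm]; exact k.2.trans hK)⟩,
    fun a b hab => Nat.div_le_div_right hab, fun i => ?_⟩
  refine (Fintype.card_le_of_injective (β := Fin t)
    (fun k => ⟨k.1 % t, Nat.mod_lt _ (Nat.succ_pos _)⟩) fun a b hab => ?_).trans_eq
    (Fintype.card_fin t)
  have ha : (a.1 : ℕ) / t = i := congrArg Fin.val a.2
  have hb : (b.1 : ℕ) / t = i := congrArg Fin.val b.2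
  simp only [Fin.mk.injEq] at hab
  refine Subtype.ext (Fin.ext ?_)
  rw [← Nat.div_add_mod (a.1 : ℕ) t, ← Nat.div_add_mod (b.1 : ℕ) t, ha, hb, hab]

/-- The length scale of the blocks. -/
noncomputable def blockLength (q N : ℕ) : ℕ := ⌈Real.sqrt (Real.logb q N)⌉₊

theorem tendsto_sqrt_logb {q : ℕ} (hq : 2 ≤ q) :
    Tendsto (fun N : ℕ => Real.sqrt (Real.logb q N)) atTop atTop :=
  Real.tendsto_sqrt_atTop.comp ((Real.tendsto_logb_atTop (by exact_mod_cast hq)).comp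
    tendsto_natCast_atTop_atTop)

theorem tendsto_blockLength {q : ℕ} (hq : 2 ≤ q) : Tendsto (blockLength q) atTop atTop :=
  tendsto_nat_ceil_atTop.comp (tendsto_sqrt_logb hq)

theorem tendsto_blockLength_div (q : ℕ) :
    Tendsto (fun N : ℕ => (blockLength q N : ℝ) / N) atTop (𝓝 0) := by
  have h1 : Tendsto (fun x : ℝ => Real.log x / x) atTop (𝓝 0) :=
    Real.isLittleO_log_id_atTop.tendsto_div_nhds_zero
  have h2 : Tendsto (fun N : ℕ => Real.log N / N / Real.log q + 2 * (1 / (N : ℝ))) atTop (𝓝 0) := by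
    simpa using ((h1.comp tendsto_natCast_atTop_atTop).div_const (Real.log q)).add
      (tendsto_one_div_atTop_nhds_zero_nat.const_mul 2)
  refine squeeze_zero (fun N => by positivity) (fun N => ?_) h2
  have h3 : Real.sqrt (Real.logb q N) ≤ Real.logb q N + 1 := by
    have h0 : 0 ≤ Real.logb q N := div_nonneg (Real.log_natCast_nonneg N) (Real.log_natCast_nonneg q)
    rw [Real.sqrt_le_left (by linarith)]
    nlinarith
  have h4 : (blockLength q N : ℝ) ≤ Real.logb q N + 2 := by
    have := Nat.ceil_lt_add_one (Real.sqrt_nonneg (Real.logb q N))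
    unfold blockLength
    linarith
  calc (blockLength q N : ℝ) / N ≤ (Real.logb q N + 2) / N := by gcongr
    _ = _ := by unfold Real.logb; ring

variable [Fintype 𝔽]

/-- Block diagonal matrices, with blocks of about `√(log_q N)` columns, attain asymptotically the
relative covering radius `H_q⁻¹(R)`. -/
theorem eventually_exists_blockDiagonal_covers {q : ℕ} (hq : q = Fintype.card 𝔽) {R η : ℝ}
    (hR : R ∈ Set.Ioo (0 : ℝ) 1) (hη : 0 < η) {K : ℕ → ℕ}
    (hK : Tendsto (fun N : ℕ => (K N : ℝ) / N) atTop (𝓝 R)) :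
    ∀ᶠ N in atTop, ∃ (D : Matrix (Fin (K N)) (Fin N) 𝔽) (ρ : ℕ), Covers D ρ ∧
      (ρ : ℝ) ≤ (entropyQInv q R + η) * N ∧ K N * blockLength q N ≤ 2 * D.weight ∧
      D.weight ≤ K N * (2 * blockLength q N) ∧
      IsBlockDiagonalWithin D ((2 * blockLength q N : ℕ) : ℝ) := by
  have hq2 : 2 ≤ q := hq ▸ Fintype.one_lt_card
  obtain ⟨R', hR', hev⟩ := exists_eventually_covers hq hR hη
  obtain ⟨n₁, hn₁⟩ := eventually_atTop.1 hev
  obtain ⟨R₁, hR₁, hR₁'⟩ := exists_between hR'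
  have hR'0 : 0 < R' := hR.1.trans hR'
  have hs := tendsto_blockLength hq2
  have hlim : Tendsto (fun N : ℕ => 1 / (blockLength q N : ℝ) + R' * ((blockLength q N : ℝ) / N))
      atTop (𝓝 0) := by
    simpa using (tendsto_one_div_atTop_nhds_zero_nat.comp hs).add
      ((tendsto_blockLength_div q).const_mul R')
  filter_upwards [hs.eventually_ge_atTop n₁, hs.eventually_ge_atTop 1,
    hlim.eventually (gt_mem_nhds (sub_pos.2 hR₁')), hK.eventually (gt_mem_nhds hR₁),
    (tendsto_blockLength_div q).eventually (gt_mem_nhds one_pos), eventually_gt_atTop 0,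
    (tendsto_natCast_atTop_atTop.comp hs).eventually_ge_atTop (1 / R')]
    with N h1 h2 h3 h4 h5 h6 h7
  simp only [Function.comp_apply] at h7
  set s := blockLength q N
  have hNR : (0 : ℝ) < N := by exact_mod_cast h6
  have hsR : (0 : ℝ) < s := by exact_mod_cast h2
  have hsN : s ≤ N := by
    rw [div_lt_one hNR] at h5
    exact_mod_cast h5.le
  have hm : 0 < N / s := Nat.div_pos hsN h2
  obtain ⟨c, hc, hcard⟩ := exists_monotone_card_fiber h2 hsN
  obtain ⟨r, hr, hrcard⟩ := exists_monotone_card_fiber_le (K N) hm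
  have hrows : ((K N / (N / s) + 1 : ℕ) : ℝ) ≤ R' * s := by
    have hmR : (0 : ℝ) < (N / s : ℕ) := by exact_mod_cast hm
    have h8 : (N : ℝ) / s - 1 ≤ (N / s : ℕ) := by
      have : N < N / s * s + s := Nat.lt_div_mul_add h2
      have : (N : ℝ) < (N / s : ℕ) * s + s := by exact_mod_cast this
      rw [sub_le_iff_le_add, div_le_iff₀ hsR]
      linarith
    have h9 : (K N : ℝ) < R₁ * N := (div_lt_iff₀ hNR).1 h4
    have h10 : (1 : ℝ) ≤ R' * s := by
      rw [div_le_iff₀ hR'0] at h7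
      linarith
    have h11 : (N : ℝ) / s + R' * s ≤ (R' - R₁) * N := by
      have := mul_le_mul_of_nonneg_right h3.le hNR.le
      calc (N : ℝ) / s + R' * s = (1 / s + R' * (s / N)) * N := by field_simp
        _ ≤ _ := this
    have h12 : (K N : ℝ) ≤ (R' * s - 1) * (N / s : ℕ) := by
      calc (K N : ℝ) ≤ (R' * s - 1) * ((N : ℝ) / s - 1) := by
            have : R' * s * ((N : ℝ) / s) = R' * N := by field_simp
            linarith
        _ ≤ _ := mul_le_mul_of_nonneg_left h8 (by linarith)
    have h13 : ((K N / (N / s) : ℕ) : ℝ) ≤ (K N : ℝ) / (N / s : ℕ) := Nat.cast_div_le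
    have h14 := (div_le_iff₀ hmR).2 h12
    push_cast at h13 h14 ⊢
    linarith
  have hblock : ∀ i, ∃ (D : Matrix {k // r k = i} {n // c n = i} 𝔽) (ρ : ℕ), Covers D ρ ∧
      (ρ : ℝ) ≤ (entropyQInv q R + η) * Fintype.card {n // c n = i} ∧
      Fintype.card {k // r k = i} * Fintype.card {n // c n = i} ≤ 2 * D.weight := by
    intro i
    refine hn₁ _ (h1.trans (hcard i).1) _ _ rfl ?_
    calc (Fintype.card {k // r k = i} : ℝ) ≤ ((K N / (N / s) + 1 : ℕ) : ℝ) := by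
          exact_mod_cast hrcard i
      _ ≤ R' * s := hrows
      _ ≤ _ := by
        have : (s : ℝ) ≤ Fintype.card {n // c n = i} := by exact_mod_cast (hcard i).1
        gcongr
  choose D ρ hcov hρ hw using hblock
  obtain ⟨D', hD', hw', hdiag⟩ := exists_covers_of_fibers r c D hcov
  have hcN := sum_card_fiber c
  have hrK := sum_card_fiber r
  rw [Fintype.card_fin] at hcN hrK
  refine ⟨D', _, hD', ?_, ?_, ?_, N / s, r, c, hr, hc, hdiag, fun i => ?_⟩
  · calc ((∑ i, ρ i : ℕ) : ℝ)
        ≤ ∑ i, (entropyQInv q R + η) * (Fintype.card {n // c n = i} : ℝ) := by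
          rw [Nat.cast_sum]
          exact Finset.sum_le_sum fun i _ => hρ i
      _ = (entropyQInv q R + η) * N := by
          rw [← Finset.mul_sum, ← Nat.cast_sum, hcN]
  · rw [hw', Finset.mul_sum]
    calc K N * s = ∑ i, Fintype.card {k // r k = i} * s := by rw [← Finset.sum_mul, hrK]
      _ ≤ _ := Finset.sum_le_sum fun i _ => (Nat.mul_le_mul_left _ (hcard i).1).trans (hw i)
  · calc D'.weight ≤ ∑ _k : Fin (K N), 2 * s := Finset.sum_le_sum fun k _ => ?_
      _ = _ := by simp
    refine le_trans (Finset.card_le_card fun n hn => ?_)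
      ((Fintype.card_subtype fun n => c n = r k).symm.trans_le (hcard (r k)).2)
    exact Finset.mem_filter.2 ⟨Finset.mem_univ _, (hdiag k n (Finset.mem_filter.1 hn).2).symm⟩
  · have := (hcard i).2
    rw [Fintype.card_subtype] at this
    exact_mod_cast this

end Blocks

/-! ### Schemes and covering matrices -/

section Schemes

variable {𝔽 : Type*} [Field 𝔽]

theorem Scheme.mulVec_col {N K L : ℕ} {F : Matrix (Fin K) (Fin L) 𝔽} (s : Scheme N F)
    (ℓ : Fin L) : (s.D.mulVec fun n => s.E n ℓ) = fun k => F k ℓ := by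
  have := s.decodes (Pi.single ℓ 1)
  rw [Matrix.mulVec_single_one, Matrix.mulVec_single_one] at this
  exact this

variable [DecidableEq 𝔽]

/-- A decoding matrix of covering radius `ρ` serves every demand with computation cost at most
`ρ / N`. -/
theorem Covers.exists_scheme {N K L ρ : ℕ} {D : Matrix (Fin K) (Fin N) 𝔽} (h : Covers D ρ)
    (F : Matrix (Fin K) (Fin L) 𝔽) : ∃ s : Scheme N F, s.D = D ∧ s.compCost ≤ (ρ : ℝ) / N := by
  choose e he hs using fun ℓ => h fun k => F k ℓ
  have hDE : D * (Matrix.of fun n ℓ => e ℓ n) = F := by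
    ext k ℓ
    exact congrFun (hs ℓ) k
  refine ⟨⟨D, Matrix.of fun n ℓ => e ℓ n, fun w => by rw [Matrix.mulVec_mulVec, hDE]⟩, rfl, ?_⟩
  unfold Scheme.compCost
  gcongr
  exact Finset.sup_le fun ℓ _ => he ℓ

/-- The largest number of servers that compute one subfunction. -/
def Scheme.maxServers {N K L : ℕ} {F : Matrix (Fin K) (Fin L) 𝔽} (s : Scheme N F) : ℕ :=
  Finset.univ.sup fun ℓ : Fin L => (s.servers ℓ).card

theorem Scheme.compCost_eq {N K L : ℕ} {F : Matrix (Fin K) (Fin L) 𝔽} (s : Scheme N F) :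
    s.compCost = (s.maxServers : ℝ) / N := rfl

theorem Scheme.maxServers_le {N K L : ℕ} {F : Matrix (Fin K) (Fin L) 𝔽} (s : Scheme N F) :
    s.maxServers ≤ N :=
  Finset.sup_le fun _ _ => (Finset.card_le_univ _).trans_eq (Fintype.card_fin N)

theorem Scheme.commCost_eq {N K L : ℕ} {F : Matrix (Fin K) (Fin L) 𝔽} (s : Scheme N F) :
    s.commCost = (s.D.weight : ℝ) / (K * N) := by
  have : ∑ n, (s.users n).card = s.D.weight := by
    simp only [Scheme.users, Matrix.weight, hammingNorm, Finset.card_filter]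
    exact Finset.sum_comm
  rw [Scheme.commCost, this]

theorem Scheme.isLeast_compCosts {N K L : ℕ} {F : Matrix (Fin K) (Fin L) 𝔽} (s₀ : Scheme N F) :
    ∃ γ, IsLeast (compCosts N F) γ := by
  have hfin : (compCosts N F).Finite := by
    refine ((Set.finite_Iic N).image fun n : ℕ => (n : ℝ) / N).subset ?_
    rintro _ ⟨s, rfl⟩
    exact ⟨s.maxServers, s.maxServers_le, rfl⟩
  obtain ⟨γ, hγ, hmin⟩ := Set.exists_min_image _ id hfin ⟨_, s₀, rfl⟩
  exact ⟨γ, hγ, hmin⟩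

variable [Fintype 𝔽]

theorem Scheme.col_mem_hammingBall {N K L w : ℕ} {F : Matrix (Fin K) (Fin L) 𝔽} (s : Scheme N F)
    (hw : s.maxServers ≤ w) (ℓ : Fin L) : (fun n => s.E n ℓ) ∈ hammingBall 𝔽 (Fin N) w := by
  refine Finset.mem_filter.2 ⟨Finset.mem_univ _, le_trans ?_ hw⟩
  exact Finset.le_sup (f := fun ℓ : Fin L => (s.servers ℓ).card) (Finset.mem_univ ℓ)

/-- Sphere-packing bound: distinct demands need distinct columns of the encoding matrix, all of them
in a Hamming ball. -/
theorem Scheme.entropyQInv_le_compCost {q : ℕ} (hq : q = Fintype.card 𝔽) {N K L : ℕ}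
    (hN : 0 < N) (hKN : K ≤ N) {F : Matrix (Fin K) (Fin L) 𝔽}
    (hF : Function.Injective fun ℓ : Fin L => fun k => F k ℓ) (s : Scheme N F) :
    entropyQInv q (Real.logb q L / N) ≤ s.compCost := by
  have hq2 : 2 ≤ q := hq ▸ Fintype.one_lt_card
  have hq1 : (2 : ℝ) ≤ q := by exact_mod_cast hq2
  have hl : 0 < Real.log q := Real.log_pos (by linarith)
  have hNR : (0 : ℝ) < N := by exact_mod_cast hN
  have hL : L ≤ q ^ N := by
    have := Fintype.card_le_of_injective _ hF
    rw [Fintype.card_fin, Fintype.card_fun, Fintype.card_fin, ← hq] at this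
    exact this.trans (Nat.pow_le_pow_right (by omega) hKN)
  have hy0 : 0 ≤ Real.logb q L / N :=
    div_nonneg (div_nonneg (Real.log_natCast_nonneg L) hl.le) hNR.le
  have hy : Real.logb q L / N ∈ Set.Icc (0 : ℝ) 1 := by
    refine ⟨hy0, ?_⟩
    rw [div_le_one hNR, Real.logb, div_le_iff₀ hl, ← Real.log_pow]
    rcases Nat.eq_zero_or_pos L with rfl | hL0
    · rw [Nat.cast_zero, Real.log_zero, Real.log_pow]
      exact mul_nonneg (Nat.cast_nonneg _) hl.le
    · exact Real.log_le_log (by exact_mod_cast hL0) (by exact_mod_cast hL)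
  rcases lt_or_ge (1 - 1 / (q : ℝ)) s.compCost with h | h
  · exact (entropyQInv_mem hq2 hy).2.trans h.le
  · have hx : s.compCost ∈ Set.Icc 0 (1 - 1 / (q : ℝ)) := ⟨by rw [s.compCost_eq]; positivity, h⟩
    rw [entropyQInv_le_iff hq2 hy hx, div_le_iff₀ hNR, Real.logb, div_le_iff₀ hl]
    have hinj : Function.Injective fun (ℓ : Fin L) (n : Fin N) => s.E n ℓ := by
      intro a b hab
      refine hF ?_
      show (fun k => F k a) = fun k => F k b
      rw [← s.mulVec_col a, ← s.mulVec_col b]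
      exact congrArg s.D.mulVec hab
    have hcard : L ≤ (hammingBall 𝔽 (Fin N) s.maxServers).card := by
      have := Finset.card_le_card_of_injOn (s := Finset.univ) _
        (fun ℓ _ => s.col_mem_hammingBall le_rfl ℓ) hinj.injOn
      rwa [Finset.card_univ, Fintype.card_fin] at this
    have hV := card_hammingBall_le (κ := Fin N) hq hx (w := s.maxServers) (by
      rw [s.compCost_eq, Fintype.card_fin, div_mul_cancel₀ _ hNR.ne'])
    rw [Fintype.card_fin, ← entropyQ_mul_log hq2] at hV
    rcases Nat.eq_zero_or_pos L with rfl | hL0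
    · rw [Nat.cast_zero, Real.log_zero, mul_comm (entropyQ _ _), mul_assoc, entropyQ_mul_log hq2]
      exact mul_nonneg hNR.le (Real.qaryEntropy_nonneg hx.1
        (hx.2.trans (one_sub_inv_lt_one hq2).le))
    · rw [Real.log_le_iff_le_exp (by exact_mod_cast hL0)]
      calc (L : ℝ) ≤ (hammingBall 𝔽 (Fin N) s.maxServers).card := by exact_mod_cast hcard
        _ ≤ _ := hV
        _ = _ := by congr 1; ring

/-- If all demands can be served with weights at most `w`, then there are at least as many pairs of a
decoding matrix and an encoding matrix of such weights as there are demands. -/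
theorem card_pow_le_of_forall_scheme {N K L w : ℕ}
    (h : ∀ F : Matrix (Fin K) (Fin L) 𝔽, ∃ s : Scheme N F, s.maxServers ≤ w) :
    Fintype.card 𝔽 ^ (K * L) ≤
      Fintype.card 𝔽 ^ (K * N) * (hammingBall 𝔽 (Fin N) w).card ^ L := by
  choose s hs using h
  let f : (Fin K → Fin L → 𝔽) → (Fin K → Fin N → 𝔽) × (Fin L → hammingBall 𝔽 (Fin N) w) := fun F =>
    ((s F).D, fun ℓ => ⟨fun n => (s F).E n ℓ, (s F).col_mem_hammingBall (hs F) ℓ⟩)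
  have hf : Function.Injective f := by
    intro A B hAB
    have h1 : (s A).D = (s B).D := congrArg Prod.fst hAB
    funext k ℓ
    have h2 : (fun n => (s A).E n ℓ) = fun n => (s B).E n ℓ :=
      congrArg Subtype.val (congrFun (congrArg Prod.snd hAB) ℓ)
    have h3 := (s A).mulVec_col ℓ
    rw [h1, h2, (s B).mulVec_col ℓ] at h3
    exact (congrFun h3 k).symm
  have := Fintype.card_le_of_injective f hf
  simpa only [Fintype.card_fun, Fintype.card_prod, Fintype.card_fin, Fintype.card_coe, ← pow_mul,
    mul_comm K] using this

/-- No computation cost below `H_q⁻¹(R)` is achievable, however small the rate of `L` is: as `L` grows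
faster than `N`, the choice of the decoding matrix is negligible in the count of pairs. -/
theorem IsAchievable.entropyQInv_le {q : ℕ} (hq : q = Fintype.card 𝔽) {R : ℝ}
    (hR : R ∈ Set.Ioo (0 : ℝ) 1) {K L : ℕ → ℕ}
    (hK : Tendsto (fun N : ℕ => (K N : ℝ) / N) atTop (𝓝 R)) {Rf : ℝ} (hRf : 0 < Rf)
    (hL : Tendsto (fun N : ℕ => Real.logb q (L N) / N) atTop (𝓝 Rf)) {γ : ℝ}
    (h : IsAchievable 𝔽 K L γ) : entropyQInv q R ≤ γ := by
  have hq2 : 2 ≤ q := hq ▸ Fintype.one_lt_card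
  have hq1 : (2 : ℝ) ≤ q := by exact_mod_cast hq2
  have hl : 0 < Real.log q := Real.log_pos (by linarith)
  obtain ⟨ε, hε, hach⟩ := h
  by_contra! hlt
  obtain ⟨x, hx1, hx2⟩ := exists_between (max_lt hlt (entropyQInv_pos hq2 hR))
  obtain ⟨hγx, hx0⟩ := max_lt_iff.1 hx1
  have hx : x ∈ Set.Icc 0 (1 - 1 / (q : ℝ)) := ⟨hx0.le, (hx2.trans (entropyQInv_lt hq2 hR)).le⟩
  have hHx : entropyQ q x < R :=
    (lt_entropyQInv_iff hq2 (Set.Ioo_subset_Icc_self hR) hx).1 hx2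
  have hεx : ∀ᶠ N in atTop, γ + ε N < x := by
    have := hε.const_add γ
    rw [add_zero] at this
    exact this.eventually (gt_mem_nhds hγx)
  set a := Rf / 2 * Real.log q with ha
  have ha0 : 0 < a := mul_pos (half_pos hRf) hl
  have hLbig : ∀ᶠ N : ℕ in atTop, (0 : ℝ) < L N ∧ (a * N) ^ 2 / 2 ≤ (L N : ℝ) := by
    filter_upwards [hL.eventually (lt_mem_nhds (half_lt_self hRf)), eventually_gt_atTop 0]
      with N h1 h2
    have hNR : (0 : ℝ) < N := by exact_mod_cast h2
    rw [lt_div_iff₀ hNR, Real.logb, lt_div_iff₀ hl] at h1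
    have h3 : a * N < Real.log (L N) := by rw [ha]; linarith
    have h4 : (0 : ℝ) < L N := by
      refine lt_of_le_of_ne (Nat.cast_nonneg _) fun h0 => ?_
      rw [← h0, Real.log_zero] at h3
      exact absurd h3 (not_lt.2 (mul_pos ha0 hNR).le)
    refine ⟨h4, ?_⟩
    have h5 := Real.quadratic_le_exp_of_nonneg (mul_pos ha0 hNR).le
    have h6 := Real.exp_le_exp.2 h3.le
    rw [Real.exp_log h4] at h6
    nlinarith [mul_pos ha0 hNR]
  have hmain : ∀ᶠ N : ℕ in atTop,
      (K N : ℝ) / N ≤ (K N : ℝ) / N * (2 / a ^ 2 * (1 / (N : ℝ))) + entropyQ q x := by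
    filter_upwards [hach, hεx, hLbig, eventually_gt_atTop 0] with N h1 h2 h3 h4
    have hNR : (0 : ℝ) < N := by exact_mod_cast h4
    obtain ⟨hL0, hL1⟩ := h3
    have hcount := card_pow_le_of_forall_scheme (w := ⌊x * N⌋₊) fun F => by
      obtain ⟨s, hs⟩ := h1 F
      refine ⟨s, Nat.le_floor ?_⟩
      rw [s.compCost_eq] at hs
      exact (div_le_iff₀ hNR).1 (hs.trans h2.le)
    rw [← hq] at hcount
    have hV := card_hammingBall_le (κ := Fin N) hq hx (w := ⌊x * N⌋₊) (by
      rw [Fintype.card_fin]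
      exact Nat.floor_le (mul_pos hx0 hNR).le)
    rw [Fintype.card_fin, ← entropyQ_mul_log hq2] at hV
    have hcount' : (q : ℝ) ^ (K N * L N) ≤ (q : ℝ) ^ (K N * N) *
        Real.exp (N * (entropyQ q x * Real.log q)) ^ L N := by
      calc (q : ℝ) ^ (K N * L N)
          ≤ (q : ℝ) ^ (K N * N) * ((hammingBall 𝔽 (Fin N) ⌊x * N⌋₊).card : ℝ) ^ L N := by
            exact_mod_cast hcount
        _ ≤ _ := by gcongr
    have hq0 : (0 : ℝ) < q := by linarith
    have hlog := Real.log_le_log (pow_pos hq0 _) hcount'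
    rw [Real.log_mul (pow_pos hq0 _).ne' (pow_pos (Real.exp_pos _) _).ne', Real.log_pow,
      Real.log_pow, Real.log_pow, Real.log_exp] at hlog
    push_cast at hlog
    have hlog' : (K N : ℝ) * L N ≤ K N * N + L N * (N * entropyQ q x) := by
      refine le_of_mul_le_mul_right ?_ hl
      linarith
    have h5 : (K N : ℝ) / N ≤ K N / L N + entropyQ q x := by
      rw [div_add' _ _ _ hL0.ne', div_le_div_iff₀ hNR hL0]
      linarith
    refine h5.trans (add_le_add_left ?_ _)
    have h6 : (K N : ℝ) / N * (2 / a ^ 2 * (1 / (N : ℝ))) = K N / ((a * N) ^ 2 / 2) := by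
      field_simp
    rw [h6]
    gcongr
  have hlim : Tendsto (fun N : ℕ => (K N : ℝ) / N * (2 / a ^ 2 * (1 / (N : ℝ))) + entropyQ q x)
      atTop (𝓝 (entropyQ q x)) := by
    simpa using (hK.mul (tendsto_one_div_atTop_nhds_zero_nat.const_mul (2 / a ^ 2))).add_const
      (entropyQ q x)
  exact absurd (le_of_tendsto_of_tendsto hK hlim hmain) (not_le.2 hHx)

end Schemes

/-! ### The interval of computation costs, and block diagonal schemes -/

/-- A property that, for every `η > 0`, holds eventually with tolerance `η` holds eventually with some
tolerance that tends to `0`. -/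
theorem exists_tendsto_zero_of_forall_eventually {P : ℕ → ℝ → Prop}
    (hmono : ∀ N x y, x ≤ y → P N x → P N y) (h : ∀ η > 0, ∀ᶠ N in atTop, P N η) :
    ∃ ε : ℕ → ℝ, Tendsto ε atTop (𝓝 0) ∧ ∀ᶠ N in atTop, P N (ε N) := by
  have hbdd : ∀ N, BddBelow {η | 0 < η ∧ P N η} := fun N => ⟨0, fun _ hη => hη.1.le⟩
  have hinv : Tendsto (fun N : ℕ => 1 / ((N : ℝ) + 1)) atTop (𝓝 0) :=
    tendsto_one_div_add_atTop_nhds_zero_nat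
  refine ⟨fun N => sInf {η | 0 < η ∧ P N η} + 1 / ((N : ℝ) + 1), ?_, ?_⟩
  · have hinf : Tendsto (fun N => sInf {η | 0 < η ∧ P N η}) atTop (𝓝 0) := by
      refine tendsto_order.2 ⟨fun b hb => Eventually.of_forall fun N =>
        hb.trans_le (Real.sInf_nonneg fun η hη => hη.1.le), fun b hb => ?_⟩
      filter_upwards [h (b / 2) (half_pos hb)] with N hN
      exact (csInf_le (hbdd N) ⟨half_pos hb, hN⟩).trans_lt (half_lt_self hb)
    simpa using hinf.add hinv
  · filter_upwards [h 1 one_pos] with N hN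
    obtain ⟨η, hη, hlt⟩ := exists_lt_of_csInf_lt (s := {η | 0 < η ∧ P N η}) ⟨1, one_pos, hN⟩
      (lt_add_of_pos_right _ (by positivity : 0 < 1 / ((N : ℝ) + 1)))
    exact hmono N _ _ hlt.le hη.2

theorem IsBlockDiagonalWithin.mono {𝔽 : Type*} [Field 𝔽] {K N : ℕ} {D : Matrix (Fin K) (Fin N) 𝔽}
    {b b' : ℝ} (h : IsBlockDiagonalWithin D b) (hb : b ≤ b') : IsBlockDiagonalWithin D b' :=
  let ⟨m, r, c, hr, hc, hD, hcard⟩ := h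
  ⟨m, r, c, hr, hc, hD, fun i => (hcard i).trans hb⟩

theorem theorem3 {𝔽 : Type*} [Field 𝔽] [Fintype 𝔽] [DecidableEq 𝔽]
    (q : ℕ) (hq : q = Fintype.card 𝔽) (R : ℝ) (hR0 : 0 < R) (hR1 : R < 1) :
    ∃ c C : ℝ, 0 < c ∧ 0 < C ∧ ∀ K : ℕ → ℕ,
      Tendsto (fun N : ℕ => (K N : ℝ) / N) atTop (𝓝 R) →
      -- the interval that contains the optimal computation cost
      (∃ ε : ℕ → ℝ, Tendsto ε atTop (𝓝 0) ∧ ∀ᶠ N : ℕ in atTop,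
        ∀ (L : ℕ) (F : Matrix (Fin (K N)) (Fin L) 𝔽),
          ∃ γ : ℝ, IsLeast (compCosts N F) γ ∧
            γ ≤ entropyQInv q ((K N : ℝ) / N) + ε N ∧
            ((Function.Injective fun ℓ : Fin L => fun k => F k ℓ) →
              entropyQInv q (Real.logb q L / N) ≤ γ)) ∧
      -- the communication cost that suffices for an achievable computation cost
      (∀ (L : ℕ → ℕ) (Rf : ℝ), 0 < Rf →
        Tendsto (fun N : ℕ => Real.logb q (L N) / N) atTop (𝓝 Rf) →
        ∀ γ : ℝ, γ ≤ min ((Real.sqrt 5 - 1) / 2) (1 - 1 / (q : ℝ)) →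
          IsAchievable 𝔽 K L γ →
          ∃ ε : ℕ → ℝ, Tendsto ε atTop (𝓝 0) ∧ ∀ᶠ N : ℕ in atTop,
            ∀ F : Matrix (Fin (K N)) (Fin (L N)) 𝔽, ∃ s : Scheme N F,
              s.compCost ≤ γ + ε N ∧
              c * (Real.sqrt (Real.logb q N) / N) ≤ s.commCost ∧
              s.commCost ≤ C * (Real.sqrt (Real.logb q N) / N) ∧
              IsBlockDiagonalWithin s.D (C * Real.sqrt (Real.logb q N))) := by
  have hq2 : 2 ≤ q := hq ▸ Fintype.one_lt_card
  have hR : R ∈ Set.Ioo (0 : ℝ) 1 := ⟨hR0, hR1⟩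
  refine ⟨1 / 2, 4, by norm_num, by norm_num, fun K hK => ⟨?_, ?_⟩⟩
  · refine exists_tendsto_zero_of_forall_eventually (P := fun N x =>
      ∀ (L : ℕ) (F : Matrix (Fin (K N)) (Fin L) 𝔽),
          ∃ γ : ℝ, IsLeast (compCosts N F) γ ∧
            γ ≤ entropyQInv q ((K N : ℝ) / N) + x ∧
            ((Function.Injective fun ℓ : Fin L => fun k => F k ℓ) →
              entropyQInv q (Real.logb q L / N) ≤ γ)) ?_ ?_
    · intro N x y hxy h L F
      obtain ⟨γ, h1, h2, h3⟩ := h L F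
      exact ⟨γ, h1, h2.trans (by linarith), h3⟩
    · intro η hη
      filter_upwards [eventually_exists_blockDiagonal_covers hq hR (half_pos hη) hK,
        eventually_lt_entropyQInv hq2 hR hK (sub_lt_self _ (half_pos hη)),
        hK.eventually (gt_mem_nhds hR1), eventually_gt_atTop 0] with N hN h1 h2 h3 L F
      obtain ⟨D, ρ, hD, hρ, -⟩ := hN
      have hNR : (0 : ℝ) < N := by exact_mod_cast h3
      have hKN : K N ≤ N := by
        rw [div_lt_one hNR] at h2
        exact_mod_cast h2.le
      obtain ⟨s, -, hs⟩ := hD.exists_scheme F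
      obtain ⟨γ, hγ⟩ := s.isLeast_compCosts
      refine ⟨γ, hγ, ?_, fun hF => ?_⟩
      · have h4 := hγ.2 ⟨s, rfl⟩
        have h5 : (ρ : ℝ) / N ≤ entropyQInv q R + η / 2 := (div_le_iff₀ hNR).2 hρ
        have h6 : γ ≤ s.compCost := h4
        linarith
      · obtain ⟨s', rfl⟩ := hγ.1
        exact s'.entropyQInv_le_compCost hq h3 hKN hF
  · intro L Rf hRf hL γ _ hach
    have hγ := hach.entropyQInv_le hq hR hK hRf hL
    refine exists_tendsto_zero_of_forall_eventually (P := fun N x =>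
      ∀ F : Matrix (Fin (K N)) (Fin (L N)) 𝔽, ∃ s : Scheme N F,
              s.compCost ≤ γ + x ∧
              1 / 2 * (Real.sqrt (Real.logb q N) / N) ≤ s.commCost ∧
              s.commCost ≤ 4 * (Real.sqrt (Real.logb q N) / N) ∧
              IsBlockDiagonalWithin s.D (4 * Real.sqrt (Real.logb q N))) ?_ ?_
    · intro N x y hxy h F
      obtain ⟨s, h1, h2⟩ := h F
      exact ⟨s, h1.trans (by linarith), h2⟩
    · intro η hη
      filter_upwards [eventually_exists_blockDiagonal_covers hq hR hη hK,
        (tendsto_sqrt_logb hq2).eventually_ge_atTop 1, hK.eventually (lt_mem_nhds hR0),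
        eventually_gt_atTop 0] with N hN h1 h2 h3 F
      obtain ⟨D, ρ, hD, hρ, hw1, hw2, hdiag⟩ := hN
      have hNR : (0 : ℝ) < N := by exact_mod_cast h3
      have hKR : (0 : ℝ) < K N := by
        have := mul_pos h2 hNR
        rwa [div_mul_cancel₀ _ hNR.ne'] at this
      obtain ⟨s, rfl, hs⟩ := hD.exists_scheme F
      have hb1 : Real.sqrt (Real.logb q N) ≤ blockLength q N := Nat.le_ceil _
      have hb2 : (blockLength q N : ℝ) ≤ 2 * Real.sqrt (Real.logb q N) := by
        have := Nat.ceil_lt_add_one (Real.sqrt_nonneg (Real.logb q N))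
        unfold blockLength
        linarith
      have hw1' : (K N : ℝ) * blockLength q N ≤ 2 * s.D.weight := by exact_mod_cast hw1
      have hw2' : (s.D.weight : ℝ) ≤ K N * (2 * blockLength q N) := by exact_mod_cast hw2
      refine ⟨s, ?_, ?_, ?_, hdiag.mono ?_⟩
      · have := (div_le_iff₀ hNR).2 hρ
        linarith
      · rw [s.commCost_eq, le_div_iff₀ (mul_pos hKR hNR)]
        have h4 := mul_le_mul_of_nonneg_left hb1 hKR.le
        have h5 : 1 / 2 * (Real.sqrt (Real.logb q N) / N) * (K N * N) =
            1 / 2 * (K N * Real.sqrt (Real.logb q N)) := by field_simp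
        linarith
      · rw [s.commCost_eq, div_le_iff₀ (mul_pos hKR hNR)]
        have h4 := mul_le_mul_of_nonneg_left hb2 hKR.le
        have h5 : 4 * (Real.sqrt (Real.logb q N) / N) * (K N * N) =
            4 * (K N * Real.sqrt (Real.logb q N)) := by field_simp
        linarith
      · push_cast
        linarith
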